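/- All Lie algebras are finite dimensional over $\mathbf k=\mathbb R$ (resp. $\mathbb C$), and all manifolds are finite dimensional real smooth (resp. complex) manifolds; $\mathcal V^1(Y)$ is the Lie algebra of smooth (resp. holomorphic) vector fields on $Y$, $\wedge^2V\subset V\otimes V$ is the space of skew-symmetric tensors, with $x\wedge y=x\otimes y-y\otimes x$, and $[\,,\,]$ also denotes the Schouten bracket, normalised by $[A,f]=A(f)$ for a vector field $A$ and a function $f$, by $[A,B\wedge C]=[A,B]\wedge C+(-1)^{(k-1)l}B\wedge[A,C]$ and $[A,B]=-(-1)^{(k-1)(l-1)}[B,A]$ for $A,B$ of degrees $k,l$. **Definitions.** A *Lie bialgebra* $(\mathfrak g,\delta)$ is a Lie algebra $\mathfrak g$ with a linear map $\delta:\mathfrak g\to\wedge^2\mathfrak g$ whose dual map is a Lie bracket on $\mathfrak g^*$ and which satisfies $\delta[x,y]=[x,\delta(y)]+[\delta(x),y]$. Its double Lie algebra is $\mathfrak d=\mathfrak g\oplus\mathfrak g^*$ with the unique Lie bracket that extends those of $\mathfrak g$ and $\mathfrak g^*$ and leaves the pairing $\langle x+\xi,y+\eta\rangle=\langle x,\eta\rangle+\langle\xi,y\rangle$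 invariant. For $r=\sum_iu_i\otimes v_i\in\mathfrak g\otimes\mathfrak g$ put $r^\#(\xi)=\sum_i\langle\xi,u_i\rangle v_i$ for $\xi\in\mathfrak g^*$. An element $t\in\wedge^2\mathfrak g$ is a *twisting element* of $(\mathfrak g,\delta)$ if $\{-t^\#(\xi)+\xi:\xi\in\mathfrak g^*\}$ is a Lie subalgebra of $\mathfrak d$; the *twist* of $(\mathfrak g,\delta)$ by $t$ is $(\mathfrak g,\delta_t)$ with $\delta_t(x)=\delta(x)-[x,t]$. A *quasitriangular structure* of $(\mathfrak g,\delta)$ is an $r\in\mathfrak g\otimes\mathfrak g$ with ad-invariant symmetric part and $[r_{12},r_{13}]+[r_{12},r_{23}]+[r_{13},r_{23}]=0$ such that $\delta(x)=\mathrm{ad}_xr$ for all $x\in\mathfrak g$. A *Poisson structure* on $Y$ is a smooth (resp. holomorphic) bi-vector field $\pi$ with $[\pi,\pi]=0$. A *left* (resp. *right*) *$(\mathfrak g,\delta)$-Poisson space* $(Y,\pi,\sigma)$ consists of a Lie bialgebra $(\mathfrak g,\delta)$, a manifold $Y$ with a Poisson structure $\pi$, and a Lie algebra anti-homomorphism (resp.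 homomorphism) $\sigma:\mathfrak g\to\mathcal V^1(Y)$ with $[\sigma(x),\pi]=\sigma(\delta(x))$ for all $x\in\mathfrak g$, where $\sigma(\sum_iu_i\otimes v_i)=\sum_i\sigma(u_i)\otimes\sigma(v_i)$. A *mixed product Poisson structure* on $Y_1\times Y_2$ is a Poisson structure that projects to well-defined Poisson structures on $Y_1$ and on $Y_2$; for $n\ge2$, a mixed product Poisson structure on $Y_1\times\cdots\times Y_n$ is a Poisson structure whose projection to $Y_i\times Y_j$ is a well-defined mixed product Poisson structure for all $i<j$. If $V=V_1\oplus\cdots\oplus V_n$ and $A_j\in V_j\otimes V_j$, then $(A_1,\dots,A_n)\in V\otimes V$ denotes the sum of the images of the $A_j$ under the embeddings $V_j\hookrightarrow V$; the same notation is used for vectors and, pointwise, for vector fields and bi-vector fields on product manifolds. **Proposition.** Let $n\ge2$, let $(\mathfrak g_1,\delta_1),\dots,(\mathfrak g_n,\delta_n)$ be Lie bialgebras, and let $(\mathfrak g,\delta)$ be their direct product, i.e. $\mathfrak g=\mathfrak g_1\oplus\cdots\oplus\mathfrak g_n$ with $\delta(x_1,\dots,x_n)=(\delta_1(x_1),\dots,\delta_n(x_n))$.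 Let $t\in\wedge^2\mathfrak g$ be a mixed twisting element of $(\mathfrak g,\delta)$, i.e. a twisting element whose image in $\mathfrak g_j\otimes\mathfrak g_j$ under the projection $\mathfrak g\to\mathfrak g_j$ is $0$ for every $j$. 1) Let $(Y_j,\pi_j,\lambda_j)$ be left $(\mathfrak g_j,\delta_j)$-Poisson spaces for $1\le j\le n$, let $Y=Y_1\times\cdots\times Y_n$, and let $\lambda:\mathfrak g\to\mathcal V^1(Y)$, $\lambda(x_1,\dots,x_n)=(\lambda_1(x_1),\dots,\lambda_n(x_n))$. Then $\pi_Y=(\pi_1,\dots,\pi_n)+\lambda(t)$ is a mixed product Poisson structure on $Y$, and $(Y,\pi_Y,\lambda)$ is a left $(\mathfrak g,\delta_t)$-Poisson space. 2) Let $(Y_j,\pi_j,\rho_j)$ be right $(\mathfrak g_j,\delta_j)$-Poisson spaces for $1\le j\le n$, let $Y=Y_1\times\cdots\times Y_n$, and let $\rho:\mathfrak g\to\mathcal V^1(Y)$, $\rho(x_1,\dots,x_n)=(\rho_1(x_1),\dots,\rho_n(x_n))$. Then $\pi_Y=(\pi_1,\dots,\pi_n)-\rho(t)$ is a mixed product Poisson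 structure on $Y$, and $(Y,\pi_Y,\rho)$ is a right $(\mathfrak g,\delta_t)$-Poisson space. 3) If, for $1\le j\le n$, $r_j$ is a quasitriangular structure of $(\mathfrak g_j,\delta_j)$ and $\pi_j=-\lambda_j(r_j)$ in 1) (resp. $\pi_j=\rho_j(r_j)$ in 2)), then $\pi_Y=-\lambda(r-t)$ in 1) (resp. $\pi_Y=\rho(r-t)$ in 2)), where $r=(r_1,\dots,r_n)$. -/

import Mathlib

open scoped TensorProduct Manifold ContDiff

noncomputable section

/-! ### Tensors

For a finite dimensional vector space `V` over a field of characteristic zero, the space `⋀² V` is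
the subspace of skew-symmetric elements of `V ⊗ V`, and elements of `V ⊗ V` and `V ⊗ V ⊗ V` are
identified with multilinear forms on the dual space of `V`. -/

section Tensors

variable {𝕜 : Type*} [Field 𝕜] {V W : Type*} [AddCommGroup V] [Module 𝕜 V]
  [AddCommGroup W] [Module 𝕜 W]

/-- The value of `A ∈ V ⊗ V` on `ξ, η ∈ V*`; `u ⊗ v` is sent to `⟨ξ, u⟩⟨η, v⟩`. -/
def tensorEval (ξ η : Module.Dual 𝕜 V) (A : V ⊗[𝕜] V) : 𝕜 :=
  TensorProduct.dualDistrib 𝕜 V V (ξ ⊗ₜ[𝕜] η) A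

/-- The map `σ ⊗ σ : V ⊗ V → W ⊗ W` induced by a linear map `σ : V → W`. -/
abbrev tensorMap (σ : V →ₗ[𝕜] W) : V ⊗[𝕜] V →ₗ[𝕜] W ⊗[𝕜] W :=
  TensorProduct.map σ σ

/-- The flip `u ⊗ v ↦ v ⊗ u`, that is, `r ↦ r²¹`. -/
abbrev tensorFlip : V ⊗[𝕜] V →ₗ[𝕜] V ⊗[𝕜] V :=
  (TensorProduct.comm 𝕜 V V).toLinearMap

/-- Skew-symmetric elements of `V ⊗ V`, i.e. elements of `⋀² V`. -/
def IsSkew (A : V ⊗[𝕜] V) : Prop := tensorFlip A = -A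

/-- `r^# : V* → V`, which for `r = ∑ uᵢ ⊗ vᵢ` is `ξ ↦ ∑ ⟨ξ, uᵢ⟩ vᵢ`. -/
def sharp (r : V ⊗[𝕜] V) : Module.Dual 𝕜 V →ₗ[𝕜] V where
  toFun ξ := TensorProduct.lid 𝕜 V (TensorProduct.map ξ LinearMap.id r)
  map_add' ξ η := by simp [TensorProduct.map_add_left]
  map_smul' c ξ := by simp [TensorProduct.map_smul_left]

/-- `(A₁, …, Aₙ) ∈ V ⊗ V` for `V = V₁ ⊕ ⋯ ⊕ Vₙ` and `Aⱼ ∈ Vⱼ ⊗ Vⱼ`: the sum of the images of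
the `Aⱼ` under the embeddings of `Vⱼ` into `V`. -/
def tensorTuple {n : ℕ} {U : Fin n → Type*} [∀ j, AddCommGroup (U j)] [∀ j, Module 𝕜 (U j)]
    (A : ∀ j, U j ⊗[𝕜] U j) : (∀ j, U j) ⊗[𝕜] (∀ j, U j) :=
  ∑ j, tensorMap (LinearMap.single 𝕜 U j) (A j)

end Tensors

/-! ### Lie bialgebras, twists, quasitriangular structures -/

section LieBialgebras

variable {𝕜 : Type*} [Field 𝕜] {𝔤 : Type*} [LieRing 𝔤] [LieAlgebra 𝕜 𝔤]

/-- The dual map `𝔤* × 𝔤* → 𝔤*` of `δ : 𝔤 → 𝔤 ⊗ 𝔤`. -/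
def dualBracket (δ : 𝔤 →ₗ[𝕜] 𝔤 ⊗[𝕜] 𝔤) (ξ η : Module.Dual 𝕜 𝔤) : Module.Dual 𝕜 𝔤 :=
  TensorProduct.dualDistrib 𝕜 𝔤 𝔤 (ξ ⊗ₜ[𝕜] η) ∘ₗ δ

/-- `δ` is a Lie bialgebra structure on the Lie algebra `𝔤`: it takes values in `⋀² 𝔤`, its dual
map is a Lie bracket on `𝔤*`, and it is a `1`-cocycle. (Skew-symmetry of the dual map is
equivalent to `skew`.) Here `⁅x, -⁆` on `𝔤 ⊗ 𝔤` is the adjoint action. -/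
structure IsLieBialgebra (δ : 𝔤 →ₗ[𝕜] 𝔤 ⊗[𝕜] 𝔤) : Prop where
  skew : ∀ x, IsSkew (δ x)
  jacobi : ∀ ξ η ζ : Module.Dual 𝕜 𝔤,
    dualBracket δ ξ (dualBracket δ η ζ) + dualBracket δ η (dualBracket δ ζ ξ)
      + dualBracket δ ζ (dualBracket δ ξ η) = 0
  cocycle : ∀ x y : 𝔤, δ ⁅x, y⁆ = ⁅x, δ y⁆ - ⁅y, δ x⁆

/-- The coadjoint action of `𝔤` on `𝔤*`: `⟨ad*_x ξ, y⟩ = ⟨ξ, [y, x]⟩`. -/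
def coad (x : 𝔤) (ξ : Module.Dual 𝕜 𝔤) : Module.Dual 𝕜 𝔤 :=
  -(ξ ∘ₗ (LieAlgebra.ad 𝕜 𝔤 x : 𝔤 →ₗ[𝕜] 𝔤))

/-- The coadjoint action of `𝔤*` on `𝔤`: `⟨ad*_ξ x, η⟩ = ⟨x, [η, ξ]⟩`. -/
def dualCoad (δ : 𝔤 →ₗ[𝕜] 𝔤 ⊗[𝕜] 𝔤) (ξ : Module.Dual 𝕜 𝔤) (x : 𝔤) : 𝔤 :=
  TensorProduct.rid 𝕜 𝔤 (TensorProduct.map LinearMap.id ξ (δ x))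

/-- The Lie bracket of the double Lie algebra `𝔡 = 𝔤 ⊕ 𝔤*`:
`[x + ξ, y + η] = [x, y] + ad*_ξ y - ad*_η x + [ξ, η] + ad*_x η - ad*_y ξ`. -/
def doubleBracket (δ : 𝔤 →ₗ[𝕜] 𝔤 ⊗[𝕜] 𝔤) (a b : 𝔤 × Module.Dual 𝕜 𝔤) :
    𝔤 × Module.Dual 𝕜 𝔤 :=
  (⁅a.1, b.1⁆ + dualCoad δ a.2 b.1 - dualCoad δ b.2 a.1,
    dualBracket δ a.2 b.2 + coad a.1 b.2 - coad b.1 a.2)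

/-- The subspace `𝔨_r = {-r^#(ξ) + ξ : ξ ∈ 𝔤*}` of `𝔡 = 𝔤 ⊕ 𝔤*`. -/
def graphSubspace (r : 𝔤 ⊗[𝕜] 𝔤) : Submodule 𝕜 (𝔤 × Module.Dual 𝕜 𝔤) :=
  LinearMap.range ((-sharp r).prod LinearMap.id)

/-- `t ∈ ⋀² 𝔤` is a twisting element of `(𝔤, δ)` if the Lagrangian subspace `𝔨_t` is a Lie
subalgebra of the double Lie algebra. -/
structure IsTwistingElement (δ : 𝔤 →ₗ[𝕜] 𝔤 ⊗[𝕜] 𝔤) (t : 𝔤 ⊗[𝕜] 𝔤) : Prop where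
  skew : IsSkew t
  closed : ∀ a ∈ graphSubspace t, ∀ b ∈ graphSubspace t, doubleBracket δ a b ∈ graphSubspace t

/-- `δ_r(x) = ad_x r`. -/
def coboundary (r : 𝔤 ⊗[𝕜] 𝔤) : 𝔤 →ₗ[𝕜] 𝔤 ⊗[𝕜] 𝔤 where
  toFun x := ⁅x, r⁆
  map_add' x y := add_lie x y r
  map_smul' c x := smul_lie c x r

/-- The twisted co-bracket `δ_t(x) = δ(x) - [x, t]`. -/
def twistedCobracket (δ : 𝔤 →ₗ[𝕜] 𝔤 ⊗[𝕜] 𝔤) (t : 𝔤 ⊗[𝕜] 𝔤) : 𝔤 →ₗ[𝕜] 𝔤 ⊗[𝕜] 𝔤 :=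
  δ - coboundary t

/-- The Lie bracket of `𝔤` as a linear map `𝔤 ⊗ 𝔤 → 𝔤`. -/
abbrev bracketMap (𝕜 𝔤 : Type*) [Field 𝕜] [LieRing 𝔤] [LieAlgebra 𝕜 𝔤] : 𝔤 ⊗[𝕜] 𝔤 →ₗ[𝕜] 𝔤 :=
  (LieModule.toModuleHom 𝕜 𝔤 𝔤 : 𝔤 ⊗[𝕜] 𝔤 →ₗ[𝕜] 𝔤)

/-- `(a ⊗ b) ⊗ (c ⊗ d) ↦ [a, c] ⊗ (b ⊗ d)`; it sends `r ⊗ r` to `[r₁₂, r₁₃]`. -/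
def bracket1213 : (𝔤 ⊗[𝕜] 𝔤) ⊗[𝕜] (𝔤 ⊗[𝕜] 𝔤) →ₗ[𝕜] 𝔤 ⊗[𝕜] (𝔤 ⊗[𝕜] 𝔤) :=
  TensorProduct.map (bracketMap 𝕜 𝔤) LinearMap.id ∘ₗ
    (TensorProduct.tensorTensorTensorComm 𝕜 𝔤 𝔤 𝔤 𝔤).toLinearMap

/-- `(a ⊗ b) ⊗ (c ⊗ d) ↦ a ⊗ ([b, c] ⊗ d)`; it sends `r ⊗ r` to `[r₁₂, r₂₃]`. -/
def bracket1223 : (𝔤 ⊗[𝕜] 𝔤) ⊗[𝕜] (𝔤 ⊗[𝕜] 𝔤) →ₗ[𝕜] 𝔤 ⊗[𝕜] (𝔤 ⊗[𝕜] 𝔤) :=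
  TensorProduct.map LinearMap.id
      (TensorProduct.map (bracketMap 𝕜 𝔤) LinearMap.id ∘ₗ
        (TensorProduct.assoc 𝕜 𝔤 𝔤 𝔤).symm.toLinearMap) ∘ₗ
    (TensorProduct.assoc 𝕜 𝔤 𝔤 (𝔤 ⊗[𝕜] 𝔤)).toLinearMap

/-- `(a ⊗ b) ⊗ (c ⊗ d) ↦ a ⊗ (c ⊗ [b, d])`; it sends `r ⊗ r` to `[r₁₃, r₂₃]`. -/
def bracket1323 : (𝔤 ⊗[𝕜] 𝔤) ⊗[𝕜] (𝔤 ⊗[𝕜] 𝔤) →ₗ[𝕜] 𝔤 ⊗[𝕜] (𝔤 ⊗[𝕜] 𝔤) :=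
  (TensorProduct.assoc 𝕜 𝔤 𝔤 𝔤).toLinearMap ∘ₗ
    TensorProduct.map LinearMap.id (bracketMap 𝕜 𝔤) ∘ₗ
      (TensorProduct.tensorTensorTensorComm 𝕜 𝔤 𝔤 𝔤 𝔤).toLinearMap

/-- The classical Yang–Baxter operator `CYB(r) = [r₁₂, r₁₃] + [r₁₂, r₂₃] + [r₁₃, r₂₃]`. -/
def cyb (r : 𝔤 ⊗[𝕜] 𝔤) : 𝔤 ⊗[𝕜] (𝔤 ⊗[𝕜] 𝔤) :=
  bracket1213 (r ⊗ₜ[𝕜] r) + bracket1223 (r ⊗ₜ[𝕜] r) + bracket1323 (r ⊗ₜ[𝕜] r)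

/-- `r` is a quasitriangular `r`-matrix on `𝔤`: its symmetric part `(r + r²¹)/2` is ad-invariant
and `CYB(r) = 0`. -/
structure IsQuasitriangular (r : 𝔤 ⊗[𝕜] 𝔤) : Prop where
  invariant : ∀ x : 𝔤, ⁅x, (2⁻¹ : 𝕜) • (r + tensorFlip r)⁆ = 0
  cyb_eq_zero : cyb r = 0

/-- `r` is a quasitriangular structure of the Lie bialgebra `(𝔤, δ)`. -/
structure IsQuasitriangularStructure (δ : 𝔤 →ₗ[𝕜] 𝔤 ⊗[𝕜] 𝔤) (r : 𝔤 ⊗[𝕜] 𝔤) : Prop where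
  quasitriangular : IsQuasitriangular r
  cobracket_eq : δ = coboundary r

end LieBialgebras

section DirectProduct

variable {𝕜 : Type*} [Field 𝕜] {n : ℕ} {𝔤 : Fin n → Type*} [∀ j, LieRing (𝔤 j)]
  [∀ j, LieAlgebra 𝕜 (𝔤 j)]

/-- The direct product Lie bracket on `𝔤₁ ⊕ ⋯ ⊕ 𝔤ₙ`. -/
instance piLieRing {𝔤 : Fin n → Type*} [∀ j, LieRing (𝔤 j)] : LieRing (∀ j, 𝔤 j) where
  bracket x y := fun j => ⁅x j, y j⁆
  add_lie x y z := funext fun j => add_lie (x j) (y j) (z j)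
  lie_add x y z := funext fun j => lie_add (x j) (y j) (z j)
  lie_self x := funext fun j => lie_self (x j)
  leibniz_lie x y z := funext fun j => leibniz_lie (x j) (y j) (z j)

/-- The direct product Lie algebra `𝔤₁ ⊕ ⋯ ⊕ 𝔤ₙ`. -/
instance piLieAlgebra : LieAlgebra 𝕜 (∀ j, 𝔤 j) where
  lie_smul c x y := funext fun j => lie_smul c (x j) (y j)

/-- The direct product co-bracket `(x₁, …, xₙ) ↦ (δ₁(x₁), …, δₙ(xₙ))` on `𝔤₁ ⊕ ⋯ ⊕ 𝔤ₙ`. -/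
def prodCobracket (δ : ∀ j, 𝔤 j →ₗ[𝕜] 𝔤 j ⊗[𝕜] 𝔤 j) :
    (∀ j, 𝔤 j) →ₗ[𝕜] (∀ j, 𝔤 j) ⊗[𝕜] (∀ j, 𝔤 j) where
  toFun x := tensorTuple fun j => δ j (x j)
  map_add' x y := by simp [tensorTuple, Finset.sum_add_distrib]
  map_smul' c x := by simp [tensorTuple, Finset.smul_sum]

/-- `t` is a mixed twisting element of the direct product of the Lie bialgebras `(𝔤ⱼ, δⱼ)`. -/
structure IsMixedTwistingElement (δ : ∀ j, 𝔤 j →ₗ[𝕜] 𝔤 j ⊗[𝕜] 𝔤 j)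
    (t : (∀ j, 𝔤 j) ⊗[𝕜] (∀ j, 𝔤 j)) : Prop where
  twisting : IsTwistingElement (prodCobracket δ) t
  mixed : ∀ j, tensorMap (LinearMap.proj (R := 𝕜) (φ := 𝔤) j) t = 0

end DirectProduct

/-! ### Tensor fields and Poisson structures on manifolds

For `𝕜 = ℝ` the maps `ContMDiff … ∞` are the smooth maps, for `𝕜 = ℂ` the holomorphic ones. -/

section Poisson

variable {𝕜 : Type*} [RCLike 𝕜] {E : Type*} [NormedAddCommGroup E] [NormedSpace 𝕜 E]
  {H : Type*} [TopologicalSpace H] (I : ModelWithCorners 𝕜 E H)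
  {M : Type*} [TopologicalSpace M] [ChartedSpace H M]

variable (M) in
/-- (Not necessarily continuous) vector fields. -/
abbrev VField : Type _ := ∀ y : M, TangentSpace I y

variable (M) in
/-- (Not necessarily continuous) sections of `TM ⊗ TM`. -/
abbrev TField : Type _ := ∀ y : M, TangentSpace I y ⊗[𝕜] TangentSpace I y

/-- The function, defined near `y₀`, that is linear in the preferred chart at `y₀` and whose
differential at `y₀` is the covector `α`. -/
def coordFun (y₀ : M) (α : Module.Dual 𝕜 (TangentSpace I y₀)) : M → 𝕜 :=
  fun z => α (extChartAt I y₀ z)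

/-- The differential at `z` of a scalar function. -/
def differential (f : M → 𝕜) (z : M) : Module.Dual 𝕜 (TangentSpace I z) :=
  (mfderiv I 𝓘(𝕜, 𝕜) f z).toLinearMap

/-- The differential of `coordFun`, a covector field that is constant in the preferred chart
at `y₀`. -/
def coordForm (y₀ : M) (α : Module.Dual 𝕜 (TangentSpace I y₀)) (z : M) :
    Module.Dual 𝕜 (TangentSpace I z) :=
  differential I (coordFun I y₀ α) z

/-- The component `z ↦ A_z(df, dg)` of the tensor field `A` in the preferred chart at `y₀`, where
`f`, `g` are the functions, linear in that chart, that are given by `α`, `β`. -/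
def TField.component (A : TField I M) (y₀ : M) (α β : Module.Dual 𝕜 (TangentSpace I y₀)) :
    M → 𝕜 :=
  fun z => tensorEval (coordForm I y₀ α z) (coordForm I y₀ β z) (A z)

/-- The tensor field `A` is smooth (holomorphic): its components in charts are. -/
def TField.IsSmooth (A : TField I M) : Prop :=
  ∀ (y₀ : M) (α β : Module.Dual 𝕜 (TangentSpace I y₀)),
    ContMDiffAt I 𝓘(𝕜, 𝕜) ∞ (TField.component I A y₀ α β) y₀

/-- The Schouten bracket `[A, B]` of two bi-vector fields, as a trilinear form on the cotangent
space at `y₀`. For functions `f, g, h` one has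
`[A, B](df, dg, dh) = ∑ (A(df, d(B(dg, dh))) + B(df, d(A(dg, dh))))`, the sum being over the cyclic
permutations of `(f, g, h)`; this is used for the functions that are linear in the preferred chart
at `y₀` and have differentials `α, β, γ` at `y₀`. -/
def schoutenBracket (A B : TField I M) (y₀ : M) (α β γ : Module.Dual 𝕜 (TangentSpace I y₀)) :
    𝕜 :=
  (tensorEval α (differential I (TField.component I B y₀ β γ) y₀) (A y₀)
    + tensorEval β (differential I (TField.component I B y₀ γ α) y₀) (A y₀)
    + tensorEval γ (differential I (TField.component I B y₀ α β) y₀) (A y₀))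
  + (tensorEval α (differential I (TField.component I A y₀ β γ) y₀) (B y₀)
    + tensorEval β (differential I (TField.component I A y₀ γ α) y₀) (B y₀)
    + tensorEval γ (differential I (TField.component I A y₀ α β) y₀) (B y₀))

/-- The Schouten bracket `[X, A]` of a vector field and a bi-vector field, i.e. the Lie derivative
of `A` along `X`, as a bilinear form on the cotangent space at `y₀`. For functions `f, g` one has
`[X, A](df, dg) = X(A(df, dg)) - A(d(X f), dg) - A(df, d(X g))`; this is used for the functions that
are linear in the preferred chart at `y₀` and have differentials `α, β` at `y₀`. -/
def schoutenBracketVector (X : VField I M) (A : TField I M) (y₀ : M)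
    (α β : Module.Dual 𝕜 (TangentSpace I y₀)) : 𝕜 :=
  differential I (TField.component I A y₀ α β) y₀ (X y₀)
    - tensorEval (differential I (fun z => coordForm I y₀ α z (X z)) y₀) β (A y₀)
    - tensorEval α (differential I (fun z => coordForm I y₀ β z (X z)) y₀) (A y₀)

/-- `π` is a Poisson structure: a smooth (holomorphic) bi-vector field with `[π, π] = 0`. -/
structure IsPoisson (π : TField I M) : Prop where
  smooth : TField.IsSmooth I π
  skew : ∀ y, IsSkew (π y)
  schouten : ∀ (y : M) (α β γ : Module.Dual 𝕜 (TangentSpace I y)),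
    schoutenBracket I π π y α β γ = 0

variable {𝔤 : Type*} [LieRing 𝔤] [LieAlgebra 𝕜 𝔤]

/-- The tensor field `σ(r)` defined by `r ∈ 𝔤 ⊗ 𝔤` and a linear map `σ` from `𝔤` to vector
fields; if `r = ∑ xᵢ ⊗ yᵢ` it is `∑ σ(xᵢ) ⊗ σ(yᵢ)`. -/
def actionTensor (σ : 𝔤 →ₗ[𝕜] VField I M) (r : 𝔤 ⊗[𝕜] 𝔤) : TField I M :=
  fun y => tensorMap (LinearMap.proj y ∘ₗ σ) r

section Actions

variable [IsManifold I ∞ M]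

/-- `σ : 𝔤 → 𝒱¹(M)` is a left action of the Lie algebra `𝔤`: it takes values in smooth
(holomorphic) vector fields and is a Lie algebra anti-homomorphism. -/
structure IsLeftAction (σ : 𝔤 →ₗ[𝕜] VField I M) : Prop where
  smooth : ∀ x, ContMDiff I I.tangent ∞ (fun y => (⟨y, σ x y⟩ : TangentBundle I M))
  map_lie : ∀ x x', σ ⁅x, x'⁆ = VectorField.mlieBracket I (σ x') (σ x)

/-- `σ : 𝔤 → 𝒱¹(M)` is a right action of the Lie algebra `𝔤`: it takes values in smooth
(holomorphic) vector fields and is a Lie algebra homomorphism. -/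
structure IsRightAction (σ : 𝔤 →ₗ[𝕜] VField I M) : Prop where
  smooth : ∀ x, ContMDiff I I.tangent ∞ (fun y => (⟨y, σ x y⟩ : TangentBundle I M))
  map_lie : ∀ x x', σ ⁅x, x'⁆ = VectorField.mlieBracket I (σ x) (σ x')

/-- `[σ(x), π] = σ(δ(x))` for all `x ∈ 𝔤`. -/
def IsPoissonCompatible (δ : 𝔤 →ₗ[𝕜] 𝔤 ⊗[𝕜] 𝔤) (π : TField I M) (σ : 𝔤 →ₗ[𝕜] VField I M) :
    Prop :=
  ∀ (x : 𝔤) (y : M) (α β : Module.Dual 𝕜 (TangentSpace I y)),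
    schoutenBracketVector I (σ x) π y α β = tensorEval α β (actionTensor I σ (δ x) y)

/-- `(M, π, σ)` is a left `(𝔤, δ)`-Poisson space: `(𝔤, δ)` is a Lie bialgebra, `(M, π)` a Poisson
manifold and `σ` a left Poisson action of `(𝔤, δ)` on `(M, π)`. -/
structure IsLeftPoissonSpace (δ : 𝔤 →ₗ[𝕜] 𝔤 ⊗[𝕜] 𝔤) (π : TField I M)
    (σ : 𝔤 →ₗ[𝕜] VField I M) : Prop where
  bialgebra : IsLieBialgebra δ
  poisson : IsPoisson I π
  action : IsLeftAction I σ
  compatible : IsPoissonCompatible I δ π σ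

/-- `(M, π, σ)` is a right `(𝔤, δ)`-Poisson space: `(𝔤, δ)` is a Lie bialgebra, `(M, π)` a Poisson
manifold and `σ` a right Poisson action of `(𝔤, δ)` on `(M, π)`. -/
structure IsRightPoissonSpace (δ : 𝔤 →ₗ[𝕜] 𝔤 ⊗[𝕜] 𝔤) (π : TField I M)
    (σ : 𝔤 →ₗ[𝕜] VField I M) : Prop where
  bialgebra : IsLieBialgebra δ
  poisson : IsPoisson I π
  action : IsRightAction I σ
  compatible : IsPoissonCompatible I δ π σ

end Actions

variable {I} in
/-- The tensor field `π` on `M` projects to the tensor field `π'` on `N` under `φ : M → N`. -/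
def ProjectsTo {E' : Type*} [NormedAddCommGroup E'] [NormedSpace 𝕜 E']
    {H' : Type*} [TopologicalSpace H'] {I' : ModelWithCorners 𝕜 E' H'}
    {N : Type*} [TopologicalSpace N] [ChartedSpace H' N]
    (φ : M → N) (π : TField I M) (π' : TField I' N) : Prop :=
  ∀ y : M, tensorMap (mfderiv I I' φ y : TangentSpace I y →ₗ[𝕜] TangentSpace I' (φ y)) (π y)
    = π' (φ y)

/-- `π` is a mixed product Poisson structure on the product of the two manifolds `M` and `N`. -/
structure IsMixedProductTwo {E' : Type*} [NormedAddCommGroup E'] [NormedSpace 𝕜 E']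
    {H' : Type*} [TopologicalSpace H'] (I' : ModelWithCorners 𝕜 E' H')
    {N : Type*} [TopologicalSpace N] [ChartedSpace H' N]
    (π : TField (I.prod I') (M × N)) : Prop where
  poisson : IsPoisson (I.prod I') π
  fst : ∃ π₁ : TField I M, IsPoisson I π₁ ∧ ProjectsTo Prod.fst π π₁
  snd : ∃ π₂ : TField I' N, IsPoisson I' π₂ ∧ ProjectsTo Prod.snd π π₂

end Poisson

/-! ### Products of `n` manifolds -/

section Products

variable {𝕜 : Type*} [RCLike 𝕜] {n : ℕ} {E : Fin n → Type*} [∀ j, NormedAddCommGroup (E j)]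
  [∀ j, NormedSpace 𝕜 (E j)] {H : Fin n → Type*} [∀ j, TopologicalSpace (H j)]
  (I : ∀ j, ModelWithCorners 𝕜 (E j) (H j))
  {Y : Fin n → Type*} [∀ j, TopologicalSpace (Y j)] [∀ j, ChartedSpace (H j) (Y j)]

/-- The product of finitely many manifolds is a manifold. -/
instance isManifold_pi [∀ j, IsManifold (I j) ∞ (Y j)] :
    IsManifold (ModelWithCorners.pi I) ∞ (∀ j, Y j) := by
  refine isManifold_of_contDiffOn _ _ _ ?_
  rintro _ _ ⟨f, hf, rfl⟩ ⟨g, hg, rfl⟩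
  refine contDiffOn_pi.2 fun j => ?_
  have h := ((contDiffGroupoid ∞ (I j)).compatible (hf j trivial) (hg j trivial)).1
  refine ContDiffOn.comp (t := (I j).symm ⁻¹' ((f j).symm.trans (g j)).source ∩ Set.range (I j))
    (f := fun x : ∀ j, E j => x j) h
    (ContinuousLinearMap.proj (R := 𝕜) (φ := E) j).contDiff.contDiffOn ?_
  rintro x ⟨hx, y, rfl⟩
  refine ⟨?_, y j, rfl⟩
  exact ⟨hx.1 j trivial, hx.2 j trivial⟩

/-- The identification `T_{y₁}Y₁ ⊕ ⋯ ⊕ T_{yₙ}Yₙ = T_y(Y₁ × ⋯ × Yₙ)`. -/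
def tangentPi (y : ∀ j, Y j) :
    (∀ j, TangentSpace (I j) (y j)) →ₗ[𝕜] TangentSpace (ModelWithCorners.pi I) y where
  toFun v := v
  map_add' _ _ := rfl
  map_smul' _ _ := rfl

/-- The tensor field `(A₁, …, Aₙ)` on `Y₁ × ⋯ × Yₙ`. -/
def prodTField (A : ∀ j, TField (I j) (Y j)) : TField (ModelWithCorners.pi I) (∀ j, Y j) :=
  fun y => tensorMap (tangentPi I y) (tensorTuple fun j => A j (y j))

/-- The direct product action `(x₁, …, xₙ) ↦ (σ₁(x₁), …, σₙ(xₙ))` of `𝔤₁ ⊕ ⋯ ⊕ 𝔤ₙ` on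
`Y₁ × ⋯ × Yₙ`. -/
def prodAction {𝔤 : Fin n → Type*} [∀ j, LieRing (𝔤 j)] [∀ j, LieAlgebra 𝕜 (𝔤 j)]
    (σ : ∀ j, 𝔤 j →ₗ[𝕜] VField (I j) (Y j)) :
    (∀ j, 𝔤 j) →ₗ[𝕜] VField (ModelWithCorners.pi I) (∀ j, Y j) where
  toFun x y := tangentPi I y fun j => σ j (x j) (y j)
  map_add' x x' := by
    funext y
    simp only [Pi.add_apply, map_add]
    exact map_add (tangentPi I y) _ _
  map_smul' c x := by
    funext y
    simp only [Pi.smul_apply, map_smul, RingHom.id_apply]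
    exact map_smul (tangentPi I y) c _

/-- `π` is a mixed product Poisson structure on `Y₁ × ⋯ × Yₙ`: it is Poisson and for all `i < j`
it projects to a mixed product Poisson structure on `Yᵢ × Yⱼ`. -/
structure IsMixedProduct (π : TField (ModelWithCorners.pi I) (∀ j, Y j)) : Prop where
  poisson : IsPoisson (ModelWithCorners.pi I) π
  pairs : ∀ i j : Fin n, i < j → ∃ π' : TField ((I i).prod (I j)) (Y i × Y j),
    IsMixedProductTwo (I i) (I j) π' ∧ ProjectsTo (fun y : ∀ j, Y j => (y i, y j)) π π'

end Products

end

/-! The argument separates into twisting on one manifold, direct products without twist, and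
projection to pairs of factors.

Twisting. Let `σ` satisfy `σ[x, x'] = c [σ(x), σ(x')]`, with `c = 1` for right and `c = -1` for left
actions, so that both cases concern `π - c σ(t)`. In `[π - c σ(t), π - c σ(t)]` the term `[π, π]`
vanishes. On covectors `α, β, γ` the cross term is a cyclic sum of compatibility conditions, the
first one taken at `x = t^#(σ*α)`, and hence a sum of values of `δ`. The quadratic term is a cyclic
sum of brackets `[t^#(σ*α), t^#(σ*β)]` paired with `σ*γ`. The two cancel by
`IsTwistingElement.maurerCartan`, which is closure of the graph of `-t^#` paired with a third
covector; this is `IsPoisson.sub_smul_actionTensor`. Compatibility with `δ_t` holds because `σ([x,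
t])` is `c` times the Lie derivative of `σ(t)` along `σ(x)`. That `δ_t` is a Lie bialgebra structure
is `IsTwistingElement.isLieBialgebra`.

Products. In product charts, components of `(π₁, …, πₙ)` and of the product action are sums of
functions of separate variables. All conditions therefore split into the conditions on the factors,
and the twisting result applies to the product.

Projections. The image on `Yᵢ × Yⱼ` is `(πᵢ, πⱼ)` plus or minus the tensor field of `t` under the
induced action. It is Poisson by `IsPoisson.of_projectsTo`. Its further projections to `Yᵢ` and `Yⱼ`
are `πᵢ` and `πⱼ`, because the diagonal blocks of `t` vanish. The formula for quasitriangular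
structures is linearity of `σ ⊗ σ`.

All differential calculus is done with functions linear in a preferred chart; `apply_mlieBracket`
ties it to the Lie bracket of vector fields. -/

noncomputable section

/-! ### Evaluation of two-tensors on covectors. -/

section TensorEval

variable {𝕜 : Type*} [Field 𝕜] {V W : Type*} [AddCommGroup V] [Module 𝕜 V]
  [AddCommGroup W] [Module 𝕜 W]

@[simp]
theorem tensorEval_tmul (ξ η : Module.Dual 𝕜 V) (u v : V) :
    tensorEval ξ η (u ⊗ₜ[𝕜] v) = ξ u * η v := by
  simp [tensorEval]

@[simp]
theorem tensorEval_zero (ξ η : Module.Dual 𝕜 V) : tensorEval ξ η (0 : V ⊗[𝕜] V) = 0 :=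
  map_zero _

theorem tensorEval_add (ξ η : Module.Dual 𝕜 V) (A B : V ⊗[𝕜] V) :
    tensorEval ξ η (A + B) = tensorEval ξ η A + tensorEval ξ η B := map_add _ _ _

theorem tensorEval_neg (ξ η : Module.Dual 𝕜 V) (A : V ⊗[𝕜] V) :
    tensorEval ξ η (-A) = -tensorEval ξ η A := map_neg _ _

theorem tensorEval_sub (ξ η : Module.Dual 𝕜 V) (A B : V ⊗[𝕜] V) :
    tensorEval ξ η (A - B) = tensorEval ξ η A - tensorEval ξ η B := map_sub _ _ _

theorem tensorEval_smul (ξ η : Module.Dual 𝕜 V) (c : 𝕜) (A : V ⊗[𝕜] V) :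
    tensorEval ξ η (c • A) = c * tensorEval ξ η A := map_smul _ _ _

theorem tensorEval_sum {ι : Type*} (s : Finset ι) (ξ η : Module.Dual 𝕜 V) (A : ι → V ⊗[𝕜] V) :
    tensorEval ξ η (∑ i ∈ s, A i) = ∑ i ∈ s, tensorEval ξ η (A i) := map_sum _ _ _

theorem tensorEval_add_right (ξ η η' : Module.Dual 𝕜 V) (A : V ⊗[𝕜] V) :
    tensorEval ξ (η + η') A = tensorEval ξ η A + tensorEval ξ η' A := by
  simp [tensorEval, TensorProduct.tmul_add]

theorem tensorEval_smul_right (c : 𝕜) (ξ η : Module.Dual 𝕜 V) (A : V ⊗[𝕜] V) :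
    tensorEval ξ (c • η) A = c * tensorEval ξ η A := by
  simp [tensorEval, TensorProduct.tmul_smul]

theorem tensorEval_sub_right (ξ η η' : Module.Dual 𝕜 V) (A : V ⊗[𝕜] V) :
    tensorEval ξ (η - η') A = tensorEval ξ η A - tensorEval ξ η' A := by
  simp [tensorEval, TensorProduct.tmul_sub]

theorem tensorEval_tensorMap (σ : V →ₗ[𝕜] W) (ξ η : Module.Dual 𝕜 W) (A : V ⊗[𝕜] V) :
    tensorEval ξ η (tensorMap σ A) = tensorEval (ξ ∘ₗ σ) (η ∘ₗ σ) A := by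
  induction A with
  | zero => simp
  | add A B hA hB => simp only [map_add, tensorEval_add, hA, hB]
  | tmul u v => simp

theorem tensorEval_tensorFlip (ξ η : Module.Dual 𝕜 V) (A : V ⊗[𝕜] V) :
    tensorEval ξ η (tensorFlip A) = tensorEval η ξ A := by
  induction A with
  | zero => simp
  | add A B hA hB => simp only [map_add, tensorEval_add, hA, hB]
  | tmul u v => simp [mul_comm]

theorem IsSkew.tensorEval_swap {A : V ⊗[𝕜] V} (hA : IsSkew A) (ξ η : Module.Dual 𝕜 V) :
    tensorEval ξ η A = -tensorEval η ξ A := by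
  rw [← tensorEval_tensorFlip η ξ, hA, tensorEval_neg]

theorem tensorFlip_tensorMap (σ : V →ₗ[𝕜] W) (A : V ⊗[𝕜] V) :
    tensorFlip (tensorMap σ A) = tensorMap σ (tensorFlip A) := by
  induction A with
  | zero => simp
  | add A B hA hB => simp only [map_add, hA, hB]
  | tmul u v => simp

theorem IsSkew.tensorMap {A : V ⊗[𝕜] V} (hA : IsSkew A) (σ : V →ₗ[𝕜] W) :
    IsSkew (tensorMap σ A) := by
  rw [IsSkew, tensorFlip_tensorMap, hA, map_neg]

theorem IsSkew.smul {A : V ⊗[𝕜] V} (hA : IsSkew A) (c : 𝕜) : IsSkew (c • A) := by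
  rw [IsSkew, map_smul, hA, smul_neg]

theorem IsSkew.sub {A B : V ⊗[𝕜] V} (hA : IsSkew A) (hB : IsSkew B) : IsSkew (A - B) := by
  rw [IsSkew, map_sub, hA, hB]; abel

theorem IsSkew.sum {ι : Type*} (s : Finset ι) {A : ι → V ⊗[𝕜] V} (hA : ∀ i, IsSkew (A i)) :
    IsSkew (∑ i ∈ s, A i) := by
  rw [IsSkew, map_sum, ← Finset.sum_neg_distrib]
  exact Finset.sum_congr rfl fun i _ => hA i

theorem apply_sharp (r : V ⊗[𝕜] V) (ξ ζ : Module.Dual 𝕜 V) :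
    ζ (sharp r ξ) = tensorEval ξ ζ r := by
  simp only [sharp, LinearMap.coe_mk, AddHom.coe_mk]
  induction r with
  | zero => simp
  | add A B hA hB => simp only [map_add, tensorEval_add, hA, hB]
  | tmul u v => simp

theorem tensorMap_comp {U : Type*} [AddCommGroup U] [Module 𝕜 U] (τ : W →ₗ[𝕜] U)
    (σ : V →ₗ[𝕜] W) (A : V ⊗[𝕜] V) :
    tensorMap τ (tensorMap σ A) = tensorMap (τ ∘ₗ σ) A := by
  rw [tensorMap, tensorMap, tensorMap, TensorProduct.map_comp, LinearMap.comp_apply]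

theorem tensorMap_zero (A : V ⊗[𝕜] V) : tensorMap (0 : V →ₗ[𝕜] W) A = 0 := by
  rw [tensorMap, TensorProduct.map_zero_left, LinearMap.zero_apply]

theorem tensorEval_tensorTuple {n : ℕ} {U : Fin n → Type*} [∀ j, AddCommGroup (U j)]
    [∀ j, Module 𝕜 (U j)] (ξ η : Module.Dual 𝕜 (∀ j, U j)) (A : ∀ j, U j ⊗[𝕜] U j) :
    tensorEval ξ η (tensorTuple A) =
      ∑ j, tensorEval (ξ ∘ₗ LinearMap.single 𝕜 U j) (η ∘ₗ LinearMap.single 𝕜 U j) (A j) := by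
  simp only [tensorTuple, tensorEval_sum, tensorEval_tensorMap]

end TensorEval

/-! ### Twisting elements and the twisted Lie bialgebra. -/

section Bialgebra

variable {𝕜 : Type*} [Field 𝕜] {𝔤 : Type*} [LieRing 𝔤] [LieAlgebra 𝕜 𝔤]
  {δ : 𝔤 →ₗ[𝕜] 𝔤 ⊗[𝕜] 𝔤} {t : 𝔤 ⊗[𝕜] 𝔤}

/-- The covector `y ↦ ⟨ξ, [x, y]⟩`. -/
def compAd (ξ : Module.Dual 𝕜 𝔤) (x : 𝔤) : Module.Dual 𝕜 𝔤 :=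
  ξ ∘ₗ (LieAlgebra.ad 𝕜 𝔤 x : 𝔤 →ₗ[𝕜] 𝔤)

@[simp]
theorem compAd_apply (ξ : Module.Dual 𝕜 𝔤) (x y : 𝔤) : compAd ξ x y = ξ ⁅x, y⁆ := rfl

theorem tensorEval_lie (ξ η : Module.Dual 𝕜 𝔤) (x : 𝔤) (A : 𝔤 ⊗[𝕜] 𝔤) :
    tensorEval ξ η ⁅x, A⁆ = tensorEval (compAd ξ x) η A + tensorEval ξ (compAd η x) A := by
  induction A with
  | zero => simp
  | add A B hA hB => simp only [lie_add, tensorEval_add, hA, hB]; ring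
  | tmul u v => simp [TensorProduct.LieModule.lie_tmul_right, tensorEval_add]

theorem tensorFlip_lie (x : 𝔤) (A : 𝔤 ⊗[𝕜] 𝔤) : tensorFlip ⁅x, A⁆ = ⁅x, tensorFlip A⁆ := by
  induction A with
  | zero => simp
  | add A B hA hB => simp only [lie_add, map_add, hA, hB]
  | tmul u v => simp [TensorProduct.LieModule.lie_tmul_right, add_comm]

theorem IsSkew.lie (ht : IsSkew t) (x : 𝔤) : IsSkew ⁅x, t⁆ := by
  rw [IsSkew, tensorFlip_lie, ht, lie_neg]

/-- The value of `[x, t]` on two covectors, for skew-symmetric `t`. -/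
theorem IsSkew.tensorEval_lie_eq (ht : IsSkew t) (ξ η : Module.Dual 𝕜 𝔤) (x : 𝔤) :
    tensorEval ξ η ⁅x, t⁆ = η ⁅x, sharp t ξ⁆ - ξ ⁅x, sharp t η⁆ := by
  rw [tensorEval_lie, ht.tensorEval_swap (compAd ξ x), ← apply_sharp, ← apply_sharp]
  simp only [compAd_apply]
  ring

theorem dualBracket_apply (δ : 𝔤 →ₗ[𝕜] 𝔤 ⊗[𝕜] 𝔤) (ξ η : Module.Dual 𝕜 𝔤) (x : 𝔤) :
    dualBracket δ ξ η x = tensorEval ξ η (δ x) := rfl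

theorem dualBracket_add_right (δ : 𝔤 →ₗ[𝕜] 𝔤 ⊗[𝕜] 𝔤) (ξ η η' : Module.Dual 𝕜 𝔤) :
    dualBracket δ ξ (η + η') = dualBracket δ ξ η + dualBracket δ ξ η' := by
  ext x
  simp [dualBracket_apply, tensorEval_add_right]

theorem dualBracket_sub_right (δ : 𝔤 →ₗ[𝕜] 𝔤 ⊗[𝕜] 𝔤) (ξ η η' : Module.Dual 𝕜 𝔤) :
    dualBracket δ ξ (η - η') = dualBracket δ ξ η - dualBracket δ ξ η' := by
  ext x
  simp [dualBracket_apply, tensorEval_sub_right]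

theorem apply_dualCoad (δ : 𝔤 →ₗ[𝕜] 𝔤 ⊗[𝕜] 𝔤) (ξ ζ : Module.Dual 𝕜 𝔤) (x : 𝔤) :
    ζ (dualCoad δ ξ x) = dualBracket δ ζ ξ x := by
  rw [dualBracket_apply, dualCoad]
  generalize δ x = A
  induction A with
  | zero => simp
  | add A B hA hB => simp only [map_add, tensorEval_add, hA, hB]
  | tmul u v => simp [mul_comm]

theorem IsLieBialgebra.dualBracket_swap (hδ : IsLieBialgebra δ) (ξ η : Module.Dual 𝕜 𝔤) (x : 𝔤) :
    dualBracket δ ξ η x = -dualBracket δ η ξ x :=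
  (hδ.skew x).tensorEval_swap ξ η

theorem IsLieBialgebra.dualBracket_lie (hδ : IsLieBialgebra δ) (ξ η : Module.Dual 𝕜 𝔤)
    (x y : 𝔤) :
    dualBracket δ ξ η ⁅x, y⁆ =
      dualBracket δ (compAd ξ x) η y + dualBracket δ ξ (compAd η x) y
        - dualBracket δ (compAd ξ y) η x - dualBracket δ ξ (compAd η y) x := by
  simp only [dualBracket_apply, hδ.cocycle, tensorEval_sub, tensorEval_lie]
  ring

theorem twistedCobracket_apply (δ : 𝔤 →ₗ[𝕜] 𝔤 ⊗[𝕜] 𝔤) (t : 𝔤 ⊗[𝕜] 𝔤) (x : 𝔤) :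
    twistedCobracket δ t x = δ x - ⁅x, t⁆ := rfl

theorem dualBracket_twistedCobracket (ht : IsSkew t) (ξ η : Module.Dual 𝕜 𝔤) :
    dualBracket (twistedCobracket δ t) ξ η =
      dualBracket δ ξ η + (compAd η (sharp t ξ) - compAd ξ (sharp t η)) := by
  ext x
  simp only [dualBracket_apply, twistedCobracket_apply, tensorEval_sub, ht.tensorEval_lie_eq,
    LinearMap.add_apply, LinearMap.sub_apply, compAd_apply]
  rw [← lie_skew (sharp t ξ) x, ← lie_skew (sharp t η) x, map_neg, map_neg]
  ring

/-- The bracket in the double of `-t^#(ξ) + ξ` and `-t^#(η) + η` has the twisted dual bracket as its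
component in `𝔤*`: the coadjoint terms are exactly the contribution of `[x, t]`. Closure of the
graph then forces the component in `𝔤`. -/
theorem IsTwistingElement.sharp_dualBracket (ht : IsTwistingElement δ t)
    (ξ η : Module.Dual 𝕜 𝔤) :
    sharp t (dualBracket (twistedCobracket δ t) ξ η) =
      dualCoad δ ξ (sharp t η) - dualCoad δ η (sharp t ξ) - ⁅sharp t ξ, sharp t η⁆ := by
  obtain ⟨θ, hθ⟩ := ht.closed _ ⟨ξ, rfl⟩ _ ⟨η, rfl⟩
  have h1 := congrArg Prod.fst hθ
  have h2 := congrArg Prod.snd hθ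
  simp only [doubleBracket, LinearMap.prod_apply, Function.prod_apply, LinearMap.neg_apply,
    LinearMap.id_apply, lie_neg, neg_lie, neg_neg] at h1 h2
  have h3 : ∀ (ζ : Module.Dual 𝕜 𝔤) (x : 𝔤), dualCoad δ ζ (-x) = -dualCoad δ ζ x := by
    intro ζ x; simp [dualCoad]
  have h4 : ∀ (ζ : Module.Dual 𝕜 𝔤) (x : 𝔤), coad (-x) ζ = compAd ζ x := by
    intro ζ x; ext y; simp [coad]
  rw [h3, h3] at h1
  rw [h4, h4] at h2
  rw [dualBracket_twistedCobracket ht.skew, ← add_sub_assoc, ← h2, ← neg_inj, h1]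
  abel

/-- The Maurer–Cartan equation of a twisting element. -/
theorem IsTwistingElement.maurerCartan (hδ : IsLieBialgebra δ) (ht : IsTwistingElement δ t)
    (ξ η ζ : Module.Dual 𝕜 𝔤) :
    ζ ⁅sharp t ξ, sharp t η⁆ + ξ ⁅sharp t η, sharp t ζ⁆ + η ⁅sharp t ζ, sharp t ξ⁆ =
      tensorEval ξ η (δ (sharp t ζ)) + tensorEval η ζ (δ (sharp t ξ))
        + tensorEval ζ ξ (δ (sharp t η)) := by
  have h := congrArg ζ (ht.sharp_dualBracket ξ η)
  -- Skewness of `t` moves `t^#` from the twisted bracket onto `ζ`.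
  rw [apply_sharp, ht.skew.tensorEval_swap, ← apply_sharp,
    dualBracket_twistedCobracket ht.skew] at h
  simp only [map_sub, apply_dualCoad, LinearMap.add_apply, LinearMap.sub_apply,
    compAd_apply] at h
  rw [hδ.dualBracket_swap ζ η, ← lie_skew (sharp t ζ) (sharp t ξ), map_neg] at *
  simp only [dualBracket_apply] at h ⊢
  linear_combination h

/-- The correction `x ↦ [x, t]` is a coboundary, so the cocycle condition persists. Conceptually the
dual bracket is that of the Lie subalgebra `{-t^#(ξ) + ξ}`; here its Jacobi identity is expanded
directly, without invoking the Jacobi identity of the double. -/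
theorem IsTwistingElement.isLieBialgebra (hδ : IsLieBialgebra δ) (ht : IsTwistingElement δ t) :
    IsLieBialgebra (twistedCobracket δ t) where
  skew x := (hδ.skew x).sub (ht.skew.lie x)
  cocycle x y := by
    simp only [twistedCobracket_apply, hδ.cocycle, lie_sub, lie_lie]
    abel
  jacobi ξ η ζ := by
    ext w
    -- `sharp_dualBracket` removes `t^#` of a twisted bracket, and the cocycle identity for `δ[w,
    -- t^#(ξ)]` opens the remaining nested term. Only brackets of `𝔤` and dual brackets of `δ` are
    -- left.
    have key : ∀ ξ η ζ : Module.Dual 𝕜 𝔤,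
        dualBracket (twistedCobracket δ t) ξ (dualBracket (twistedCobracket δ t) η ζ) w =
          dualBracket δ ξ (dualBracket δ η ζ) w
          + dualBracket δ ξ (compAd ζ (sharp t η)) w
          - dualBracket δ ξ (compAd η (sharp t ζ)) w
          + dualBracket δ (compAd ξ w) η (sharp t ζ) - dualBracket δ (compAd ξ w) ζ (sharp t η)
          - ξ ⁅w, ⁅sharp t η, sharp t ζ⁆⁆
          - (dualBracket δ (compAd η w) ζ (sharp t ξ) + dualBracket δ η (compAd ζ w) (sharp t ξ)
            - dualBracket δ (compAd η (sharp t ξ)) ζ w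
            - dualBracket δ η (compAd ζ (sharp t ξ)) w)
          + ζ ⁅⁅w, sharp t ξ⁆, sharp t η⁆ - η ⁅⁅w, sharp t ξ⁆, sharp t ζ⁆ := by
      intro ξ η ζ
      rw [dualBracket_twistedCobracket ht.skew ξ, ht.sharp_dualBracket η ζ,
        dualBracket_twistedCobracket ht.skew η, dualBracket_add_right, dualBracket_sub_right]
      have e2 : ∀ x : 𝔤, ξ ⁅x, w⁆ = -compAd ξ w x := fun x => by
        rw [compAd_apply, ← lie_skew, map_neg]
      have e3 : ∀ x : 𝔤, ⁅⁅w, sharp t ξ⁆, x⁆ = -⁅x, ⁅w, sharp t ξ⁆⁆ := fun x => (lie_skew _ _).symm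
      have e4 := hδ.dualBracket_lie η ζ w (sharp t ξ)
      have e5 : ⁅sharp t ξ, w⁆ = -⁅w, sharp t ξ⁆ := (lie_skew _ _).symm
      simp only [LinearMap.add_apply, LinearMap.sub_apply, compAd_apply, map_sub, sub_lie, e2,
        apply_dualCoad]
      simp only [e3, e5, lie_neg, map_neg]
      linear_combination -e4
    have jac := LinearMap.congr_fun (hδ.jacobi ξ η ζ) w
    simp only [LinearMap.add_apply, LinearMap.zero_apply] at jac ⊢
    rw [key, key, key]
    have j1 := congrArg ξ (leibniz_lie w (sharp t η) (sharp t ζ))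
    have j2 := congrArg η (leibniz_lie w (sharp t ζ) (sharp t ξ))
    have j3 := congrArg ζ (leibniz_lie w (sharp t ξ) (sharp t η))
    rw [map_add, ← lie_skew _ ⁅w, _⁆, map_neg] at j1 j2 j3
    have sw := hδ.dualBracket_swap
    -- In the cyclic sum the terms free of `t` cancel by Jacobi for the dual of `δ`, the linear ones
    -- by its antisymmetry, and the quadratic ones by Jacobi in `𝔤`.
    linear_combination jac - j1 - j2 - j3 + sw ξ (compAd ζ (sharp t η)) w
      + sw η (compAd ξ (sharp t ζ)) w + sw ζ (compAd η (sharp t ξ)) w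
      - sw (compAd ξ w) ζ (sharp t η) - sw (compAd η w) ξ (sharp t ζ)
      - sw (compAd ζ w) η (sharp t ξ)

end Bialgebra

/-! ### Direct products of Lie bialgebras. -/

section ProductBialgebra

variable {𝕜 : Type*} [Field 𝕜] {n : ℕ} {𝔤 : Fin n → Type*} [∀ j, LieRing (𝔤 j)]
  [∀ j, LieAlgebra 𝕜 (𝔤 j)]

theorem lie_tensorTuple (x : ∀ j, 𝔤 j) (A : ∀ j, 𝔤 j ⊗[𝕜] 𝔤 j) :
    ⁅x, tensorTuple A⁆ = tensorTuple fun j => ⁅x j, A j⁆ := by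
  rw [tensorTuple, tensorTuple, lie_sum]
  refine Finset.sum_congr rfl fun j _ => ?_
  have hj : ∀ u : 𝔤 j, ⁅x, LinearMap.single 𝕜 𝔤 j u⁆ = LinearMap.single 𝕜 𝔤 j ⁅x j, u⁆ := by
    intro u
    ext i
    change ⁅x i, (Pi.single j u : ∀ j, 𝔤 j) i⁆ = (Pi.single j ⁅x j, u⁆ : ∀ j, 𝔤 j) i
    by_cases h : i = j
    · subst h
      simp
    · simp [h]
  induction A j with
  | zero => simp
  | add A B hA hB => simp only [lie_add, map_add, hA, hB]
  | tmul u v =>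
    simp only [tensorMap, TensorProduct.map_tmul, TensorProduct.LieModule.lie_tmul_right, hj,
      map_add]

theorem isLieBialgebra_prodCobracket {δ : ∀ j, 𝔤 j →ₗ[𝕜] 𝔤 j ⊗[𝕜] 𝔤 j}
    (hδ : ∀ j, IsLieBialgebra (δ j)) : IsLieBialgebra (prodCobracket δ) where
  skew x := IsSkew.sum Finset.univ fun j =>
    ((hδ j).skew (x j)).tensorMap (LinearMap.single 𝕜 𝔤 j)
  cocycle x y := by
    change tensorTuple (fun j => δ j ⁅x j, y j⁆) = ⁅x, tensorTuple fun j => δ j (y j)⁆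
      - ⁅y, tensorTuple fun j => δ j (x j)⁆
    simp only [lie_tensorTuple, (hδ _).cocycle]
    simp only [tensorTuple, map_sub, Finset.sum_sub_distrib]
  jacobi ξ η ζ := by
    have h : ∀ (ξ η : Module.Dual 𝕜 (∀ j, 𝔤 j)) (x : ∀ j, 𝔤 j),
        dualBracket (prodCobracket δ) ξ η x = ∑ j, dualBracket (δ j)
          (ξ ∘ₗ LinearMap.single 𝕜 𝔤 j) (η ∘ₗ LinearMap.single 𝕜 𝔤 j) (x j) :=
      fun ξ η x => tensorEval_tensorTuple ξ η _
    -- Restriction to a factor commutes with the dual bracket, so nested brackets, and hence Jacobi,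
    -- can be treated one factor at a time.
    have h' : ∀ (ξ η : Module.Dual 𝕜 (∀ j, 𝔤 j)) (j : Fin n),
        dualBracket (prodCobracket δ) ξ η ∘ₗ LinearMap.single 𝕜 𝔤 j = dualBracket (δ j)
          (ξ ∘ₗ LinearMap.single 𝕜 𝔤 j) (η ∘ₗ LinearMap.single 𝕜 𝔤 j) := by
      intro ξ η j
      ext x
      rw [LinearMap.comp_apply, h, Finset.sum_eq_single j]
      · simp
      · intro i _ hi
        simp [hi]
      · simp
    refine LinearMap.ext fun x => ?_
    simp only [LinearMap.add_apply, LinearMap.zero_apply, h, h', ← Finset.sum_add_distrib]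
    exact Finset.sum_eq_zero fun j _ => LinearMap.congr_fun ((hδ j).jacobi _ _ _) (x j)

end ProductBialgebra

/-! ### Rules for the differential of scalar functions. -/

section Differential

variable {𝕜 : Type*} [RCLike 𝕜] {E : Type*} [NormedAddCommGroup E] [NormedSpace 𝕜 E]
  {H : Type*} [TopologicalSpace H] {I : ModelWithCorners 𝕜 E H}
  {M : Type*} [TopologicalSpace M] [ChartedSpace H M]
  {E' : Type*} [NormedAddCommGroup E'] [NormedSpace 𝕜 E']
  {H' : Type*} [TopologicalSpace H'] {I' : ModelWithCorners 𝕜 E' H'}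
  {N : Type*} [TopologicalSpace N] [ChartedSpace H' N]
  {f g : M → 𝕜} {z : M}

theorem differential_congr (h : f =ᶠ[nhds z] g) : differential I f z = differential I g z := by
  rw [differential, differential, h.mfderiv_eq]

theorem differential_add (hf : MDifferentiableAt I 𝓘(𝕜, 𝕜) f z)
    (hg : MDifferentiableAt I 𝓘(𝕜, 𝕜) g z) :
    differential I (fun y => f y + g y) z = differential I f z + differential I g z := by
  have h := (hf.hasMFDerivAt.add hg.hasMFDerivAt).mfderiv
  exact congrArg ContinuousLinearMap.toLinearMap h

theorem differential_const_mul (c : 𝕜) (hf : MDifferentiableAt I 𝓘(𝕜, 𝕜) f z) :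
    differential I (fun y => c * f y) z = c • differential I f z := by
  have h := (hf.hasMFDerivAt.const_smul c).mfderiv
  exact congrArg ContinuousLinearMap.toLinearMap h

theorem differential_mul (hf : MDifferentiableAt I 𝓘(𝕜, 𝕜) f z)
    (hg : MDifferentiableAt I 𝓘(𝕜, 𝕜) g z) :
    differential I (fun y => f y * g y) z =
      f z • differential I g z + g z • differential I f z := by
  have h := (HasMFDerivAt.mul hf.hasMFDerivAt hg.hasMFDerivAt).mfderiv
  exact congrArg ContinuousLinearMap.toLinearMap h

theorem differential_sum {ι : Type} {s : Finset ι} {f : ι → M → 𝕜}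
    (hf : ∀ i ∈ s, MDifferentiableAt I 𝓘(𝕜, 𝕜) (f i) z) :
    differential I (fun y => ∑ i ∈ s, f i y) z = ∑ i ∈ s, differential I (f i) z := by
  let D : ι → E →L[𝕜] 𝕜 := fun i => mfderiv I 𝓘(𝕜, 𝕜) (f i) z
  have h := (HasMFDerivAt.sum (I := I) (z := z) (t := s) (f := f) (f' := D)
    (fun i hi => by exact (hf i hi).hasMFDerivAt)).mfderiv
  have e : (fun y => ∑ i ∈ s, f i y) = ∑ i ∈ s, f i := by ext; simp
  ext v
  rw [differential, e, h, LinearMap.sum_apply]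
  exact sum_apply s D (show E from v)

theorem differential_comp {f : N → 𝕜} {φ : M → N}
    {φ' : TangentSpace I z →L[𝕜] TangentSpace I' (φ z)}
    (hf : MDifferentiableAt I' 𝓘(𝕜, 𝕜) f (φ z)) (hφ : HasMFDerivAt I I' φ z φ') :
    differential I (fun y => f (φ y)) z = differential I' f (φ z) ∘ₗ φ'.toLinearMap := by
  have h := (hf.hasMFDerivAt.comp z hφ).mfderiv
  exact congrArg ContinuousLinearMap.toLinearMap h

end Differential

/-! ### Vector fields and Lie brackets in preferred charts. -/

section Coordinates

variable {𝕜 : Type*} [RCLike 𝕜] {E : Type*} [NormedAddCommGroup E] [NormedSpace 𝕜 E]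
  [FiniteDimensional 𝕜 E]
  {H : Type*} [TopologicalSpace H] {I : ModelWithCorners 𝕜 E H}
  {M : Type*} [TopologicalSpace M] [ChartedSpace H M] [IsManifold I ∞ M]

/-- A covector, as a continuous linear form on the model space. -/
def covectorCLM {y₀ : M} (α : Module.Dual 𝕜 (TangentSpace I y₀)) : E →L[𝕜] 𝕜 :=
  LinearMap.toContinuousLinearMap (show E →ₗ[𝕜] 𝕜 from α)

theorem contMDiffAt_coordFun {y₀ z : M} (hz : z ∈ (chartAt H y₀).source)
    (α : Module.Dual 𝕜 (TangentSpace I y₀)) :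
    ContMDiffAt I 𝓘(𝕜, 𝕜) ∞ (coordFun I y₀ α) z :=
  (covectorCLM α).contMDiff.contMDiffAt.comp z (contMDiffAt_extChartAt' hz)

theorem coordForm_apply {y₀ z : M} (hz : z ∈ (chartAt H y₀).source)
    (α : Module.Dual 𝕜 (TangentSpace I y₀)) (v : TangentSpace I z) :
    coordForm I y₀ α z v = covectorCLM α (mfderiv I 𝓘(𝕜, E) (extChartAt I y₀) z v) := by
  have h := (((covectorCLM α).hasMFDerivAt (x := extChartAt I y₀ z)).comp z
    (mdifferentiableAt_extChartAt (I := I) hz).hasMFDerivAt).mfderiv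
  exact DFunLike.congr_fun h v

/-- The preferred chart at `y₀` has identity derivative at `y₀`. -/
theorem coordForm_self (y₀ : M) (α : Module.Dual 𝕜 (TangentSpace I y₀)) :
    coordForm I y₀ α y₀ = α := by
  refine LinearMap.ext fun v => ?_
  rw [coordForm_apply (mem_chart_source H y₀), mfderiv_extChartAt_self]
  rfl

/-- The vector field `X` applied to the function that is linear in the preferred chart at `y₀` and
has differential `α` there. -/
def vectorComponent (X : VField I M) (y₀ : M) (α : Module.Dual 𝕜 (TangentSpace I y₀)) : M → 𝕜 :=
  fun z => coordForm I y₀ α z (X z)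

omit [FiniteDimensional 𝕜 E] [IsManifold I ∞ M] in
theorem contMDiffAt_dual_iff {F : Type*} [NormedAddCommGroup F] [NormedSpace 𝕜 F]
    [FiniteDimensional 𝕜 F] {φ : M → F} {y₀ : M} :
    ContMDiffAt I 𝓘(𝕜, F) ∞ φ y₀ ↔
      ∀ α : F →L[𝕜] 𝕜, ContMDiffAt I 𝓘(𝕜, 𝕜) ∞ (fun z => α (φ z)) y₀ := by
  refine ⟨fun h α => α.contMDiff.contMDiffAt.comp y₀ h, fun h => ?_⟩
  let e : F ≃L[𝕜] (Fin (Module.finrank 𝕜 F) → 𝕜) := (Module.finBasis 𝕜 F).equivFunL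
  have h1 : ContMDiffAt I 𝓘(𝕜, Fin (Module.finrank 𝕜 F) → 𝕜) ∞ (fun z => e (φ z)) y₀ :=
    contMDiffAt_pi_space.2 fun i =>
      h ((ContinuousLinearMap.proj (R := 𝕜) (φ := fun _ => 𝕜) i).comp e.toContinuousLinearMap)
  have h2 := e.symm.toContinuousLinearMap.contMDiff.contMDiffAt.comp y₀ h1
  refine h2.congr_of_eventuallyEq (Filter.Eventually.of_forall fun z => ?_)
  simp

/-- The tangent bundle trivialization at `y₀` is the derivative of the preferred chart, so
components are linear forms of the trivialized field; in finite dimension these detect smoothness.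
-/
theorem contMDiffAt_section_iff_vectorComponent (X : VField I M) (y₀ : M) :
    ContMDiffAt I I.tangent ∞ (fun y => (⟨y, X y⟩ : TangentBundle I M)) y₀ ↔
      ∀ α : Module.Dual 𝕜 (TangentSpace I y₀),
        ContMDiffAt I 𝓘(𝕜, 𝕜) ∞ (vectorComponent X y₀ α) y₀ := by
  have h1 := Bundle.contMDiffAt_section (IB := I) (F := E) (E := (TangentSpace I : M → Type _))
    (n := ∞) (s := X) y₀
  rw [contMDiffAt_dual_iff] at h1
  refine h1.trans ?_
  have key : ∀ α : Module.Dual 𝕜 (TangentSpace I y₀), vectorComponent X y₀ α =ᶠ[nhds y₀]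
      fun z => covectorCLM α (trivializationAt E (TangentSpace I) y₀ ⟨z, X z⟩).2 := by
    intro α
    filter_upwards [(chartAt H y₀).open_source.mem_nhds (mem_chart_source H y₀)] with z hz
    rw [vectorComponent, coordForm_apply hz,
      ← TangentBundle.continuousLinearMapAt_trivializationAt hz]
    have e := Bundle.Trivialization.coe_linearMapAt_of_mem (R := 𝕜)
      (trivializationAt E (TangentSpace I : M → Type _) y₀) (b := z) (by simpa using hz)
    exact congrArg (covectorCLM α) (congrFun e (X z))
  constructor
  · intro h α
    exact (h (covectorCLM α)).congr_of_eventuallyEq (key α)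
  · intro h α
    exact (h α.toLinearMap).congr_of_eventuallyEq (key α.toLinearMap).symm

/-- The vector field `Z`, written in the preferred chart at `y₀`. -/
def vectorInChart (Z : VField I M) (y₀ : M) : E → E :=
  VectorField.mpullbackWithin 𝓘(𝕜, E) I (extChartAt I y₀).symm Z (Set.range I)

omit [FiniteDimensional 𝕜 E] in
theorem vectorInChart_self (Z : VField I M) (y₀ : M) :
    vectorInChart Z y₀ (extChartAt I y₀ y₀) = Z y₀ := by
  have h := mfderivWithin_extChartAt_symm_inverse_apply (I := I) (x := y₀)
    (Z ((extChartAt I y₀).symm (extChartAt I y₀ y₀)) : E)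
  refine h.trans ?_
  rw [extChartAt_to_inv]

theorem covectorCLM_vectorInChart (Z : VField I M) {y₀ : M} {e : E}
    (he : e ∈ (extChartAt I y₀).target) (α : Module.Dual 𝕜 (TangentSpace I y₀)) :
    covectorCLM α (vectorInChart Z y₀ e) = vectorComponent Z y₀ α ((extChartAt I y₀).symm e) := by
  have h1 : (extChartAt I y₀).symm e ∈ (chartAt H y₀).source := by
    rw [← extChartAt_source I]
    exact (extChartAt I y₀).map_target he
  have h2 := ContinuousLinearMap.inverse_eq
    (mfderivWithin_extChartAt_symm_comp_mfderiv_extChartAt he)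
    (mfderiv_extChartAt_comp_mfderivWithin_extChartAt_symm he)
  rw [vectorComponent, coordForm_apply h1]
  exact congrArg (covectorCLM α) (DFunLike.congr_fun h2 (Z ((extChartAt I y₀).symm e)))

/-- Read in the chart, the component is the constant covector `α` composed with the pulled-back
field, so `α` passes through the derivative. -/
theorem differential_vectorComponent {Z : VField I M} {y₀ : M}
    (hZ : ContMDiffAt I I.tangent ∞ (fun y => (⟨y, Z y⟩ : TangentBundle I M)) y₀)
    (α : Module.Dual 𝕜 (TangentSpace I y₀)) (v : TangentSpace I y₀) :
    differential I (vectorComponent Z y₀ α) y₀ v =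
      covectorCLM α (fderivWithin 𝕜 (vectorInChart Z y₀) (Set.range I) (extChartAt I y₀ y₀)
        (show E from v)) := by
  have : CompleteSpace E := FiniteDimensional.complete 𝕜 E
  have hd := ((contMDiffAt_section_iff_vectorComponent Z y₀).1 hZ α).mdifferentiableAt
    (by simp)
  have hd' : DifferentiableWithinAt 𝕜 (vectorInChart Z y₀) (Set.range I) (extChartAt I y₀ y₀) := by
    have h := (hZ.mdifferentiableAt (by simp)).mdifferentiableWithinAt (s := Set.univ)
      |>.differentiableWithinAt_mpullbackWithin_vectorField
    rwa [Set.preimage_univ, Set.univ_inter] at h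
  have hU := I.uniqueDiffOn.uniqueDiffWithinAt (Set.mem_range_self (chartAt H y₀ y₀))
  have e1 := ((covectorCLM α).hasFDerivAt.comp_hasFDerivWithinAt _
    hd'.hasFDerivWithinAt).fderivWithin hU
  have e2 : writtenInExtChartAt I 𝓘(𝕜, 𝕜) y₀ (vectorComponent Z y₀ α)
      =ᶠ[nhdsWithin (extChartAt I y₀ y₀) (Set.range I)]
      covectorCLM α ∘ vectorInChart Z y₀ := by
    filter_upwards [extChartAt_target_mem_nhdsWithin (I := I) y₀] with e he
    exact (covectorCLM_vectorInChart Z he α).symm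
  have e3 := e2.fderivWithin_eq (𝕜 := 𝕜) (e2.eq_of_nhdsWithin (Set.mem_range_self _))
  rw [e1] at e3
  exact DFunLike.congr_fun (hd.mfderiv.trans e3) v

/-- This is `[X, Y]f = X(Yf) - Y(Xf)` for `f` linear in the chart with differential `α`. It turns
the action property into an identity between differentials of components. -/
theorem apply_mlieBracket {X Y : VField I M} {y₀ : M}
    (hX : ContMDiffAt I I.tangent ∞ (fun y => (⟨y, X y⟩ : TangentBundle I M)) y₀)
    (hY : ContMDiffAt I I.tangent ∞ (fun y => (⟨y, Y y⟩ : TangentBundle I M)) y₀)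
    (α : Module.Dual 𝕜 (TangentSpace I y₀)) :
    α (VectorField.mlieBracket I X Y y₀) =
      differential I (vectorComponent Y y₀ α) y₀ (X y₀)
        - differential I (vectorComponent X y₀ α) y₀ (Y y₀) := by
  have h1 : VectorField.mlieBracket I X Y y₀ =
      VectorField.lieBracketWithin 𝕜 (vectorInChart X y₀) (vectorInChart Y y₀) (Set.range I)
        (extChartAt I y₀ y₀) := by
    rw [← VectorField.mlieBracketWithin_univ, VectorField.mlieBracketWithin_apply,
      mfderiv_extChartAt_self, Set.preimage_univ, Set.univ_inter]
    exact DFunLike.congr_fun ContinuousLinearMap.inverse_id _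
  rw [h1, differential_vectorComponent hY, differential_vectorComponent hX,
    VectorField.lieBracketWithin, vectorInChart_self, vectorInChart_self]
  exact map_sub (covectorCLM α) _ _

end Coordinates

/-! ### Twisting a Poisson structure on a single manifold. -/

section Twist

variable {𝕜 : Type*} [RCLike 𝕜] {E : Type*} [NormedAddCommGroup E] [NormedSpace 𝕜 E]
  {H : Type*} [TopologicalSpace H] {I : ModelWithCorners 𝕜 E H}
  {M : Type*} [TopologicalSpace M] [ChartedSpace H M]
  {𝔤 : Type*} [LieRing 𝔤] [LieAlgebra 𝕜 𝔤]

/-- The covector `x ↦ ⟨α, σ(x)⟩` on `𝔤`. -/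
def actionPullback (σ : 𝔤 →ₗ[𝕜] VField I M) {y : M} (α : Module.Dual 𝕜 (TangentSpace I y)) :
    Module.Dual 𝕜 𝔤 :=
  α ∘ₗ (LinearMap.proj y ∘ₗ σ)

@[simp]
theorem actionPullback_apply (σ : 𝔤 →ₗ[𝕜] VField I M) {y : M}
    (α : Module.Dual 𝕜 (TangentSpace I y)) (x : 𝔤) : actionPullback σ α x = α (σ x y) := rfl

theorem tensorEval_actionTensor (σ : 𝔤 →ₗ[𝕜] VField I M) (t : 𝔤 ⊗[𝕜] 𝔤) {y : M}
    (α β : Module.Dual 𝕜 (TangentSpace I y)) :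
    tensorEval α β (actionTensor I σ t y) =
      tensorEval (actionPullback σ α) (actionPullback σ β) t :=
  tensorEval_tensorMap _ _ _ _

theorem tensorEval_actionTensor_eq_apply (σ : 𝔤 →ₗ[𝕜] VField I M) (t : 𝔤 ⊗[𝕜] 𝔤) {y : M}
    (α β : Module.Dual 𝕜 (TangentSpace I y)) :
    tensorEval α β (actionTensor I σ t y) = β (σ (sharp t (actionPullback σ α)) y) := by
  rw [tensorEval_actionTensor, ← apply_sharp, actionPullback_apply]

theorem sharp_add (r s : 𝔤 ⊗[𝕜] 𝔤) (ξ : Module.Dual 𝕜 𝔤) :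
    sharp (r + s) ξ = sharp r ξ + sharp s ξ := by
  simp [sharp]

theorem sharp_zero (ξ : Module.Dual 𝕜 𝔤) : sharp (0 : 𝔤 ⊗[𝕜] 𝔤) ξ = 0 := by
  simp [sharp]

theorem sharp_neg (r : 𝔤 ⊗[𝕜] 𝔤) (ξ : Module.Dual 𝕜 𝔤) : sharp (-r) ξ = -sharp r ξ := by
  simp [sharp]

theorem sharp_tmul (u v : 𝔤) (ξ : Module.Dual 𝕜 𝔤) : sharp (u ⊗ₜ[𝕜] v) ξ = ξ u • v := by
  simp [sharp]

theorem TField.component_sub_smul (A B : TField I M) (c : 𝕜) (y₀ : M)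
    (α β : Module.Dual 𝕜 (TangentSpace I y₀)) :
    TField.component I (A - c • B) y₀ α β =
      fun z => TField.component I A y₀ α β z - c * TField.component I B y₀ α β z := by
  funext z
  simp only [TField.component, Pi.sub_apply, Pi.smul_apply, tensorEval_sub, tensorEval_smul]

variable [FiniteDimensional 𝕜 E] [IsManifold I ∞ M] {σ : 𝔤 →ₗ[𝕜] VField I M}

/-- For `t = u ⊗ v` this is the Leibniz rule for a product of two components; the undifferentiated
factors at `y₀` are the scalars `⟨α, σ(u)⟩` and `⟨β, σ(v)⟩`, which assemble into `t^#` and the sharp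
of the flip. Smoothness is carried along because the additive step differentiates a sum. -/
theorem differential_component_actionTensor
    (hσ : ∀ x, ContMDiff I I.tangent ∞ (fun y => (⟨y, σ x y⟩ : TangentBundle I M)))
    (t : 𝔤 ⊗[𝕜] 𝔤) (y₀ : M) (α β : Module.Dual 𝕜 (TangentSpace I y₀)) :
    ContMDiffAt I 𝓘(𝕜, 𝕜) ∞ (TField.component I (actionTensor I σ t) y₀ α β) y₀ ∧
    differential I (TField.component I (actionTensor I σ t) y₀ α β) y₀ =
      differential I (vectorComponent (σ (sharp t (actionPullback σ α))) y₀ β) y₀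
      + differential I (vectorComponent (σ (sharp (tensorFlip t) (actionPullback σ β))) y₀ α)
        y₀ := by
  have hs : ∀ (x : 𝔤) (α : Module.Dual 𝕜 (TangentSpace I y₀)),
      ContMDiffAt I 𝓘(𝕜, 𝕜) ∞ (vectorComponent (σ x) y₀ α) y₀ := fun x α =>
    (contMDiffAt_section_iff_vectorComponent (σ x) y₀).1 (hσ x y₀) α
  have hd : ∀ (x : 𝔤) (α : Module.Dual 𝕜 (TangentSpace I y₀)),
      MDifferentiableAt I 𝓘(𝕜, 𝕜) (vectorComponent (σ x) y₀ α) y₀ := fun x α =>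
    (hs x α).mdifferentiableAt (by simp)
  have hsmul : ∀ (c : 𝕜) (x : 𝔤) (α : Module.Dual 𝕜 (TangentSpace I y₀)),
      differential I (vectorComponent (σ (c • x)) y₀ α) y₀ =
        c • differential I (vectorComponent (σ x) y₀ α) y₀ := by
    intro c x α
    rw [← differential_const_mul c (hd x α)]
    congr 1
    funext z
    simp [vectorComponent]
  have hadd : ∀ (x x' : 𝔤) (α : Module.Dual 𝕜 (TangentSpace I y₀)),
      differential I (vectorComponent (σ (x + x')) y₀ α) y₀ =
        differential I (vectorComponent (σ x) y₀ α) y₀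
          + differential I (vectorComponent (σ x') y₀ α) y₀ := by
    intro x x' α
    rw [← differential_add (hd x α) (hd x' α)]
    congr 1
    funext z
    simp [vectorComponent]
  induction t with
  | zero =>
    have h0 : ∀ α : Module.Dual 𝕜 (TangentSpace I y₀),
        differential I (vectorComponent (σ 0) y₀ α) y₀ = 0 := fun α => by
      simpa using hsmul 0 0 α
    -- Zero is written as a product so that the constant multiple rule gives its differential.
    have h1 : TField.component I (actionTensor I σ 0) y₀ α β = fun z => 0 * (0 : 𝕜) := by
      funext z
      simp [TField.component, actionTensor]
    refine ⟨h1 ▸ contMDiffAt_const, ?_⟩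
    rw [h1, differential_const_mul 0 mdifferentiableAt_const, map_zero, sharp_zero, sharp_zero,
      h0, h0]
    simp
  | add A B hA hB =>
    have h1 : TField.component I (actionTensor I σ (A + B)) y₀ α β = fun z =>
        TField.component I (actionTensor I σ A) y₀ α β z
          + TField.component I (actionTensor I σ B) y₀ α β z := by
      funext z
      simp [TField.component, actionTensor, tensorEval_add]
    refine ⟨h1 ▸ hA.1.add hB.1, ?_⟩
    rw [h1, differential_add (hA.1.mdifferentiableAt (by simp))
      (hB.1.mdifferentiableAt (by simp)), hA.2, hB.2, map_add, sharp_add, sharp_add, hadd, hadd]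
    abel
  | tmul u v =>
    have h1 : TField.component I (actionTensor I σ (u ⊗ₜ v)) y₀ α β = fun z =>
        vectorComponent (σ u) y₀ α z * vectorComponent (σ v) y₀ β z := by
      funext z
      simp [TField.component, actionTensor, vectorComponent]
    refine ⟨h1 ▸ (hs u α).mul (hs v β), ?_⟩
    have h2 : tensorFlip (u ⊗ₜ[𝕜] v) = v ⊗ₜ[𝕜] u := rfl
    rw [h1, differential_mul (hd u α) (hd v β), h2, sharp_tmul, sharp_tmul, hsmul, hsmul]
    simp only [vectorComponent, coordForm_self, actionPullback_apply]

theorem differential_component_actionTensor_of_isSkew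
    (hσ : ∀ x, ContMDiff I I.tangent ∞ (fun y => (⟨y, σ x y⟩ : TangentBundle I M)))
    {t : 𝔤 ⊗[𝕜] 𝔤} (ht : IsSkew t) (y₀ : M) (α β : Module.Dual 𝕜 (TangentSpace I y₀)) :
    differential I (TField.component I (actionTensor I σ t) y₀ α β) y₀ =
      differential I (vectorComponent (σ (sharp t (actionPullback σ α))) y₀ β) y₀
      - differential I (vectorComponent (σ (sharp t (actionPullback σ β))) y₀ α) y₀ := by
  rw [(differential_component_actionTensor hσ t y₀ α β).2, ht, sharp_neg, sub_eq_add_neg]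
  congr 1
  have h := (contMDiffAt_section_iff_vectorComponent (σ (sharp t (actionPullback σ β))) y₀).1
    (hσ _ y₀) α
  rw [← neg_one_smul 𝕜 (differential I _ y₀),
    ← differential_const_mul (-1) (h.mdifferentiableAt (by simp))]
  congr 1
  funext z
  simp [vectorComponent]

variable {δ : 𝔤 →ₗ[𝕜] 𝔤 ⊗[𝕜] 𝔤} {t : 𝔤 ⊗[𝕜] 𝔤} {π : TField I M} {c : 𝕜}

theorem TField.IsSmooth.sub_smul_actionTensor
    (hσ : ∀ x, ContMDiff I I.tangent ∞ (fun y => (⟨y, σ x y⟩ : TangentBundle I M)))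
    (hπ : TField.IsSmooth I π) (c : 𝕜) (t : 𝔤 ⊗[𝕜] 𝔤) :
    TField.IsSmooth I (π - c • actionTensor I σ t) := fun y α β => by
  rw [TField.component_sub_smul]
  exact (hπ y α β).sub
    (contMDiffAt_const.mul (differential_component_actionTensor hσ t y α β).1)

theorem differential_component_sub_smul_actionTensor
    (hσ : ∀ x, ContMDiff I I.tangent ∞ (fun y => (⟨y, σ x y⟩ : TangentBundle I M)))
    (hπ : TField.IsSmooth I π) (ht : IsSkew t) (y₀ : M)
    (α β : Module.Dual 𝕜 (TangentSpace I y₀)) :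
    differential I (TField.component I (π - c • actionTensor I σ t) y₀ α β) y₀ =
      differential I (TField.component I π y₀ α β) y₀
      - c • (differential I (vectorComponent (σ (sharp t (actionPullback σ α))) y₀ β) y₀
        - differential I (vectorComponent (σ (sharp t (actionPullback σ β))) y₀ α) y₀) := by
  have h1 := (hπ y₀ α β).mdifferentiableAt (by simp)
  have h2 := (differential_component_actionTensor hσ t y₀ α β).1.mdifferentiableAt (by simp)
  have h3 : MDifferentiableAt I 𝓘(𝕜, 𝕜)
      (fun z => -c * TField.component I (actionTensor I σ t) y₀ α β z) y₀ :=
    ((contMDiffAt_const.mul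
      (differential_component_actionTensor hσ t y₀ α β).1)).mdifferentiableAt (by simp)
  rw [TField.component_sub_smul]
  simp only [sub_eq_add_neg (TField.component I π y₀ α β _), ← neg_mul]
  rw [differential_add h1 h3, differential_const_mul _ h2,
    differential_component_actionTensor_of_isSkew hσ ht]
  module

/-- The twist of a Poisson structure with a Poisson action of `(𝔤, δ)` by a twisting element is a
Poisson structure; `c = 1` for right actions and `c = -1` for left actions. -/
theorem IsPoisson.sub_smul_actionTensor (hδ : IsLieBialgebra δ) (ht : IsTwistingElement δ t)
    (hπ : IsPoisson I π)
    (hσ : ∀ x, ContMDiff I I.tangent ∞ (fun y => (⟨y, σ x y⟩ : TangentBundle I M)))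
    (hlie : ∀ x x', σ ⁅x, x'⁆ = c • VectorField.mlieBracket I (σ x) (σ x'))
    (hcomp : IsPoissonCompatible I δ π σ) :
    IsPoisson I (π - c • actionTensor I σ t) where
  smooth := hπ.smooth.sub_smul_actionTensor hσ c t
  skew y := (hπ.skew y).sub ((ht.skew.tensorMap _).smul c)
  schouten y α β γ := by
    have hb : ∀ (a b : 𝔤) (α : Module.Dual 𝕜 (TangentSpace I y)),
        actionPullback σ α ⁅a, b⁆ = c * (differential I (vectorComponent (σ b) y α) y (σ a y)
          - differential I (vectorComponent (σ a) y α) y (σ b y)) := by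
      intro a b α
      rw [actionPullback_apply, hlie, Pi.smul_apply, map_smul,
        apply_mlieBracket (hσ a y) (hσ b y), smul_eq_mul]
    have hs := hπ.schouten y α β γ
    have c1 := hcomp (sharp t (actionPullback σ α)) y β γ
    have c2 := hcomp (sharp t (actionPullback σ β)) y γ α
    have c3 := hcomp (sharp t (actionPullback σ γ)) y α β
    have mc := ht.maurerCartan hδ (actionPullback σ α) (actionPullback σ β) (actionPullback σ γ)
    rw [hb, hb, hb] at mc
    -- Skewness of `π` puts every differential in the second slot, as in the Schouten bracket.
    rw [tensorEval_actionTensor, schoutenBracketVector, (hπ.skew y).tensorEval_swap _ γ] at c1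
    rw [tensorEval_actionTensor, schoutenBracketVector, (hπ.skew y).tensorEval_swap _ α] at c2
    rw [tensorEval_actionTensor, schoutenBracketVector, (hπ.skew y).tensorEval_swap _ β] at c3
    unfold schoutenBracket at hs ⊢
    simp only [differential_component_sub_smul_actionTensor hσ hπ.smooth ht.skew, Pi.sub_apply,
      Pi.smul_apply, tensorEval_sub, tensorEval_smul, tensorEval_actionTensor_eq_apply,
      tensorEval_sub_right, tensorEval_smul_right]
    unfold vectorComponent at mc ⊢
    -- The `2` appears because `schoutenBracket` with equal arguments repeats the same cyclic sum.
    -- The cross terms, weighted by `c`, become values of `δ` through `c1`, `c2`, `c3`; `mc` matches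
    -- these with the terms weighted by `c²`, its second `c` coming from the action property.
    linear_combination hs + 2 * c * mc - 2 * c * c1 - 2 * c * c2 - 2 * c * c3

/-- The Lie derivative along `σ(x)` obeys the Leibniz rule on `σ(t)`, so `σ([x, t])` equals `c
[σ(x), σ(t)]`. Skewness of `t` suffices; the Maurer–Cartan equation plays no role here. -/
theorem IsPoissonCompatible.sub_smul_actionTensor (ht : IsSkew t)
    (hπ : TField.IsSmooth I π)
    (hσ : ∀ x, ContMDiff I I.tangent ∞ (fun y => (⟨y, σ x y⟩ : TangentBundle I M)))
    (hlie : ∀ x x', σ ⁅x, x'⁆ = c • VectorField.mlieBracket I (σ x) (σ x'))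
    (hcomp : IsPoissonCompatible I δ π σ) :
    IsPoissonCompatible I (twistedCobracket δ t) (π - c • actionTensor I σ t) σ := by
  intro x y α β
  have hb : ∀ (a b : 𝔤) (α : Module.Dual 𝕜 (TangentSpace I y)),
      actionPullback σ α ⁅a, b⁆ = c * (differential I (vectorComponent (σ b) y α) y (σ a y)
        - differential I (vectorComponent (σ a) y α) y (σ b y)) := by
    intro a b α
    rw [actionPullback_apply, hlie, Pi.smul_apply, map_smul,
      apply_mlieBracket (hσ a y) (hσ b y), smul_eq_mul]
  have h := hcomp x y α β
  have hsk : IsSkew (actionTensor I σ t y) := ht.tensorMap _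
  rw [tensorEval_actionTensor] at h ⊢
  rw [twistedCobracket_apply, tensorEval_sub, ht.tensorEval_lie_eq, hb, hb, ← h]
  unfold schoutenBracketVector
  simp only [differential_component_sub_smul_actionTensor hσ hπ ht, Pi.sub_apply,
    Pi.smul_apply, tensorEval_sub, tensorEval_smul, hsk.tensorEval_swap _ β,
    tensorEval_actionTensor_eq_apply, LinearMap.sub_apply, LinearMap.smul_apply, smul_eq_mul]
  unfold vectorComponent
  ring

theorem IsLeftPoissonSpace.twist (ht : IsTwistingElement δ t)
    (h : IsLeftPoissonSpace I δ π σ) :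
    IsLeftPoissonSpace I (twistedCobracket δ t) (π + actionTensor I σ t) σ := by
  have e : π + actionTensor I σ t = π - (-1 : 𝕜) • actionTensor I σ t := by
    rw [neg_one_smul, sub_neg_eq_add]
  have hlie : ∀ x x', σ ⁅x, x'⁆ = (-1 : 𝕜) • VectorField.mlieBracket I (σ x) (σ x') := by
    intro x x'
    rw [h.action.map_lie, VectorField.mlieBracket_swap, neg_one_smul]
  rw [e]
  exact ⟨ht.isLieBialgebra h.bialgebra, h.poisson.sub_smul_actionTensor h.bialgebra ht
    h.action.smooth hlie h.compatible, h.action, h.compatible.sub_smul_actionTensor ht.skew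
    h.poisson.smooth h.action.smooth hlie⟩

theorem IsRightPoissonSpace.twist (ht : IsTwistingElement δ t)
    (h : IsRightPoissonSpace I δ π σ) :
    IsRightPoissonSpace I (twistedCobracket δ t) (π - actionTensor I σ t) σ := by
  have e : π - actionTensor I σ t = π - (1 : 𝕜) • actionTensor I σ t := by
    rw [one_smul]
  have hlie : ∀ x x', σ ⁅x, x'⁆ = (1 : 𝕜) • VectorField.mlieBracket I (σ x) (σ x') := by
    intro x x'
    rw [h.action.map_lie, one_smul]
  rw [e]
  exact ⟨ht.isLieBialgebra h.bialgebra, h.poisson.sub_smul_actionTensor h.bialgebra ht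
    h.action.smooth hlie h.compatible, h.action, h.compatible.sub_smul_actionTensor ht.skew
    h.poisson.smooth h.action.smooth hlie⟩

end Twist

/-! ### Products of manifolds, actions and Poisson spaces. -/

section ProductManifold

variable {𝕜 : Type*} [RCLike 𝕜] {n : ℕ} {E : Fin n → Type*} [∀ j, NormedAddCommGroup (E j)]
  [∀ j, NormedSpace 𝕜 (E j)] {H : Fin n → Type*} [∀ j, TopologicalSpace (H j)]
  {I : ∀ j, ModelWithCorners 𝕜 (E j) (H j)}
  {Y : Fin n → Type*} [∀ j, TopologicalSpace (Y j)] [∀ j, ChartedSpace (H j) (Y j)]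

theorem mem_chartAt_pi_source {y z : ∀ j, Y j} :
    z ∈ (chartAt (ModelPi H) y).source ↔ ∀ j, z j ∈ (chartAt (H j) (y j)).source := by
  rw [piChartedSpace_chartAt]
  simp [Set.mem_pi]

theorem contMDiff_pi_iff {E' : Type*} [NormedAddCommGroup E'] [NormedSpace 𝕜 E']
    {H' : Type*} [TopologicalSpace H'] {I' : ModelWithCorners 𝕜 E' H'}
    {N : Type*} [TopologicalSpace N] [ChartedSpace H' N] {f : N → ∀ j, Y j} :
    ContMDiff I' (ModelWithCorners.pi I) ∞ f ↔ ∀ j, ContMDiff I' (I j) ∞ fun x => f x j := by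
  have h : ∀ x, ContMDiffAt I' (ModelWithCorners.pi I) ∞ f x ↔
      ∀ j, ContMDiffAt I' (I j) ∞ (fun x => f x j) x := by
    intro x
    have h1 := fun j => contMDiffAt_iff_target (I := I') (I' := I j) (n := ∞)
      (f := fun x => f x j) (x := x)
    rw [contMDiffAt_iff_target, continuousAt_pi, forall_congr' h1, forall_and]
    exact and_congr_right fun _ => contMDiffAt_pi_space
  exact ⟨fun hf j x => (h x).1 (hf x) j, fun hf x => (h x).2 fun j => hf j x⟩

theorem contMDiff_pi_apply (j : Fin n) :
    ContMDiff (ModelWithCorners.pi I) (I j) ∞ (fun y : ∀ j, Y j => y j) :=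
  contMDiff_pi_iff.1 contMDiff_id j

theorem hasMFDerivAt_pi_apply (y : ∀ j, Y j) (j : Fin n) :
    HasMFDerivAt (ModelWithCorners.pi I) (I j) (fun y : ∀ j, Y j => y j) y
      (ContinuousLinearMap.proj (R := 𝕜) (φ := E) j) := by
  refine ⟨(continuous_apply j).continuousAt, ?_⟩
  refine (ContinuousLinearMap.proj (R := 𝕜) (φ := E) j).hasFDerivWithinAt.congr_of_eventuallyEq
    ?_ ?_
  · filter_upwards [extChartAt_target_mem_nhdsWithin (I := ModelWithCorners.pi I) y] with e he
    exact congrFun ((extChartAt (ModelWithCorners.pi I) y).right_inv he) j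
  · exact congrFun ((extChartAt (ModelWithCorners.pi I) y).right_inv
      (mem_extChartAt_target y)) j

/-- The restriction of a covector on `Y₁ × ⋯ × Yₙ` to the tangent space of the `j`-th factor. -/
def restrictCovector {y : ∀ j, Y j}
    (α : Module.Dual 𝕜 (TangentSpace (ModelWithCorners.pi I) y)) (j : Fin n) :
    Module.Dual 𝕜 (TangentSpace (I j) (y j)) :=
  α ∘ₗ tangentPi I y ∘ₗ LinearMap.single 𝕜 (fun j => TangentSpace (I j) (y j)) j

theorem covector_tangentPi {y : ∀ j, Y j}
    (α : Module.Dual 𝕜 (TangentSpace (ModelWithCorners.pi I) y))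
    (v : ∀ j, TangentSpace (I j) (y j)) :
    α (tangentPi I y v) = ∑ j, restrictCovector α j (v j) := by
  conv_lhs => rw [← Finset.univ_sum_single v, map_sum, map_sum]
  rfl

theorem tensorEval_prodTField (A : ∀ j, TField (I j) (Y j)) (y : ∀ j, Y j)
    (α β : Module.Dual 𝕜 (TangentSpace (ModelWithCorners.pi I) y)) :
    tensorEval α β (prodTField I A y) =
      ∑ j, tensorEval (restrictCovector α j) (restrictCovector β j) (A j (y j)) := by
  rw [prodTField, tensorEval_tensorMap, tensorEval_tensorTuple]
  rfl

theorem mdifferentiableAt_sum_pi_apply {f : ∀ j, Y j → 𝕜} {y : ∀ j, Y j}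
    (hf : ∀ j, MDifferentiableAt (I j) 𝓘(𝕜, 𝕜) (f j) (y j)) (j : Fin n) :
    MDifferentiableAt (ModelWithCorners.pi I) 𝓘(𝕜, 𝕜) (fun z : ∀ j, Y j => f j (z j)) y :=
  (hf j).comp y (hasMFDerivAt_pi_apply y j).mdifferentiableAt

/-- A sum of functions of separate variables has as its `j`-th partial differential that of the
`j`-th summand. This is what makes every condition on the product split over the factors. -/
theorem restrictCovector_differential {f : ∀ j, Y j → 𝕜} {y : ∀ j, Y j}
    (hf : ∀ j, MDifferentiableAt (I j) 𝓘(𝕜, 𝕜) (f j) (y j)) (j : Fin n) :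
    restrictCovector (differential (ModelWithCorners.pi I) (fun z => ∑ j, f j (z j)) y) j =
      differential (I j) (f j) (y j) := by
  rw [differential_sum fun i _ => mdifferentiableAt_sum_pi_apply hf i]
  refine LinearMap.ext fun v => ?_
  rw [restrictCovector, LinearMap.comp_apply, LinearMap.sum_apply, Finset.sum_eq_single j]
  · rw [differential_comp (hf j) (hasMFDerivAt_pi_apply y j)]
    exact congrArg (differential (I j) (f j) (y j)) (Pi.single_eq_same j v)
  · intro i _ hi
    rw [differential_comp (hf i) (hasMFDerivAt_pi_apply y i)]
    exact (congrArg (differential (I i) (f i) (y i)) (Pi.single_eq_of_ne hi v)).trans (map_zero _)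
  · simp

variable [∀ j, FiniteDimensional 𝕜 (E j)] [∀ j, IsManifold (I j) ∞ (Y j)]

/-- Preferred charts of the product are products of preferred charts, so a function linear in such a
chart is a sum of functions linear in the charts of the factors. -/
theorem restrictCovector_coordForm {y z : ∀ j, Y j} (hz : z ∈ (chartAt (ModelPi H) y).source)
    (α : Module.Dual 𝕜 (TangentSpace (ModelWithCorners.pi I) y)) (j : Fin n) :
    restrictCovector (coordForm (ModelWithCorners.pi I) y α z) j =
      coordForm (I j) (y j) (restrictCovector α j) (z j) := by
  have h : coordFun (ModelWithCorners.pi I) y α =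
      fun z => ∑ j, coordFun (I j) (y j) (restrictCovector α j) (z j) := by
    funext z
    exact covector_tangentPi α (fun j => extChartAt (I j) (y j) (z j))
  rw [coordForm, h, restrictCovector_differential]
  · rfl
  · exact fun j => (contMDiffAt_coordFun (mem_chartAt_pi_source.1 hz j) _).mdifferentiableAt
      (by simp)

theorem component_prodTField_eventuallyEq (A : ∀ j, TField (I j) (Y j)) (y : ∀ j, Y j)
    (α β : Module.Dual 𝕜 (TangentSpace (ModelWithCorners.pi I) y)) :
    TField.component (ModelWithCorners.pi I) (prodTField I A) y α β =ᶠ[nhds y] fun z =>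
      ∑ j, TField.component (I j) (A j) (y j) (restrictCovector α j) (restrictCovector β j)
        (z j) := by
  filter_upwards [(chartAt (ModelPi H) y).open_source.mem_nhds (mem_chart_source _ y)] with z hz
  rw [TField.component, tensorEval_prodTField]
  simp only [restrictCovector_coordForm hz]
  rfl

variable {𝔤 : Fin n → Type*} [∀ j, LieRing (𝔤 j)] [∀ j, LieAlgebra 𝕜 (𝔤 j)]
  {δ : ∀ j, 𝔤 j →ₗ[𝕜] 𝔤 j ⊗[𝕜] 𝔤 j} {π : ∀ j, TField (I j) (Y j)}
  {σ : ∀ j, 𝔤 j →ₗ[𝕜] VField (I j) (Y j)}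

theorem vectorComponent_prodAction_eventuallyEq (x : ∀ j, 𝔤 j) (y : ∀ j, Y j)
    (α : Module.Dual 𝕜 (TangentSpace (ModelWithCorners.pi I) y)) :
    vectorComponent (prodAction I σ x) y α =ᶠ[nhds y] fun z =>
      ∑ j, vectorComponent (σ j (x j)) (y j) (restrictCovector α j) (z j) := by
  filter_upwards [(chartAt (ModelPi H) y).open_source.mem_nhds (mem_chart_source _ y)] with z hz
  have h := covector_tangentPi (coordForm (ModelWithCorners.pi I) y α z)
    fun j => σ j (x j) (z j)
  simp only [restrictCovector_coordForm hz] at h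
  exact h

omit [∀ j, FiniteDimensional 𝕜 (E j)] [∀ j, IsManifold (I j) ∞ (Y j)] in
theorem contMDiffAt_sum_pi_apply {f : ∀ j, Y j → 𝕜} {y : ∀ j, Y j}
    (hf : ∀ j, ContMDiffAt (I j) 𝓘(𝕜, 𝕜) ∞ (f j) (y j)) :
    ContMDiffAt (ModelWithCorners.pi I) 𝓘(𝕜, 𝕜) ∞ (fun z : ∀ j, Y j => ∑ j, f j (z j)) y :=
  contMDiffAt_finsetSum fun j _ => (hf j).comp y (contMDiff_pi_apply j y)

theorem restrictCovector_differential_component (hπ : ∀ j, TField.IsSmooth (I j) (π j))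
    (y : ∀ j, Y j) (α β : Module.Dual 𝕜 (TangentSpace (ModelWithCorners.pi I) y)) (j : Fin n) :
    restrictCovector (differential (ModelWithCorners.pi I)
      (TField.component (ModelWithCorners.pi I) (prodTField I π) y α β) y) j =
    differential (I j) (TField.component (I j) (π j) (y j) (restrictCovector α j)
      (restrictCovector β j)) (y j) := by
  rw [differential_congr (component_prodTField_eventuallyEq π y α β)]
  exact restrictCovector_differential
    (fun j => (hπ j (y j) _ _).mdifferentiableAt (by simp)) j

theorem restrictCovector_differential_vectorComponent
    (hσ : ∀ j x, ContMDiff (I j) (I j).tangent ∞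
      (fun y => (⟨y, σ j x y⟩ : TangentBundle (I j) (Y j))))
    (x : ∀ j, 𝔤 j) (y : ∀ j, Y j)
    (α : Module.Dual 𝕜 (TangentSpace (ModelWithCorners.pi I) y)) (j : Fin n) :
    restrictCovector (differential (ModelWithCorners.pi I)
      (vectorComponent (prodAction I σ x) y α) y) j =
    differential (I j) (vectorComponent (σ j (x j)) (y j) (restrictCovector α j)) (y j) := by
  rw [differential_congr (vectorComponent_prodAction_eventuallyEq x y α)]
  exact restrictCovector_differential (fun j => ((contMDiffAt_section_iff_vectorComponent _ _).1
    (hσ j (x j) (y j)) _).mdifferentiableAt (by simp)) j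

omit [∀ j, FiniteDimensional 𝕜 (E j)] [∀ j, IsManifold (I j) ∞ (Y j)] in
theorem covector_prodAction (x : ∀ j, 𝔤 j) {y : ∀ j, Y j}
    (α : Module.Dual 𝕜 (TangentSpace (ModelWithCorners.pi I) y)) :
    α (prodAction I σ x y) = ∑ j, restrictCovector α j (σ j (x j) (y j)) :=
  covector_tangentPi α fun j => σ j (x j) (y j)

theorem isPoisson_prodTField (hπ : ∀ j, IsPoisson (I j) (π j)) :
    IsPoisson (ModelWithCorners.pi I) (prodTField I π) where
  smooth y α β := (contMDiffAt_sum_pi_apply fun j =>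
    (hπ j).smooth (y j) (restrictCovector α j) (restrictCovector β j)).congr_of_eventuallyEq
      (component_prodTField_eventuallyEq π y α β)
  skew y := (IsSkew.sum Finset.univ fun j => ((hπ j).skew (y j)).tensorMap
    (LinearMap.single 𝕜 (fun j => TangentSpace (I j) (y j)) j)).tensorMap _
  schouten y α β γ := by
    have h : ∀ j, schoutenBracket (I j) (π j) (π j) (y j) (restrictCovector α j)
        (restrictCovector β j) (restrictCovector γ j) = 0 := fun j => (hπ j).schouten _ _ _ _
    have hsm := fun j => (hπ j).smooth
    unfold schoutenBracket at h ⊢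
    simp only [tensorEval_prodTField, restrictCovector_differential_component hsm,
      ← Finset.sum_add_distrib]
    exact Finset.sum_eq_zero fun j _ => h j

theorem contMDiff_prodAction
    (hσ : ∀ j x, ContMDiff (I j) (I j).tangent ∞
      (fun y => (⟨y, σ j x y⟩ : TangentBundle (I j) (Y j)))) (x : ∀ j, 𝔤 j) :
    ContMDiff (ModelWithCorners.pi I) (ModelWithCorners.pi I).tangent ∞
      (fun y => (⟨y, prodAction I σ x y⟩ :
        TangentBundle (ModelWithCorners.pi I) (∀ j, Y j))) := fun y => by
  refine (contMDiffAt_section_iff_vectorComponent _ _).2 fun α => ?_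
  refine (contMDiffAt_sum_pi_apply fun j => ?_).congr_of_eventuallyEq
    (vectorComponent_prodAction_eventuallyEq x y α)
  exact (contMDiffAt_section_iff_vectorComponent _ _).1 (hσ j (x j) (y j)) _

theorem mlieBracket_prodAction
    (hσ : ∀ j x, ContMDiff (I j) (I j).tangent ∞
      (fun y => (⟨y, σ j x y⟩ : TangentBundle (I j) (Y j)))) (x x' : ∀ j, 𝔤 j) (y : ∀ j, Y j) :
    VectorField.mlieBracket (ModelWithCorners.pi I) (prodAction I σ x) (prodAction I σ x') y =
      tangentPi I y fun j => VectorField.mlieBracket (I j) (σ j (x j)) (σ j (x' j)) (y j) := by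
  -- Covectors separate tangent vectors, so the bracket may be computed through `apply_mlieBracket`.
  refine sub_eq_zero.1 ((Module.forall_dual_apply_eq_zero_iff 𝕜 _).1 fun α => ?_)
  rw [map_sub, sub_eq_zero, apply_mlieBracket (contMDiff_prodAction hσ x y)
    (contMDiff_prodAction hσ x' y), covector_prodAction, covector_prodAction, covector_tangentPi,
    ← Finset.sum_sub_distrib]
  refine Finset.sum_congr rfl fun j _ => ?_
  rw [restrictCovector_differential_vectorComponent hσ,
    restrictCovector_differential_vectorComponent hσ,
    apply_mlieBracket (hσ j (x j) (y j)) (hσ j (x' j) (y j))]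

theorem isLeftAction_prodAction (h : ∀ j, IsLeftAction (I j) (σ j)) :
    IsLeftAction (ModelWithCorners.pi I) (prodAction I σ) where
  smooth := contMDiff_prodAction fun j => (h j).smooth
  map_lie x x' := by
    funext y
    rw [mlieBracket_prodAction fun j => (h j).smooth]
    simp only [← (h _).map_lie]
    rfl

theorem isRightAction_prodAction (h : ∀ j, IsRightAction (I j) (σ j)) :
    IsRightAction (ModelWithCorners.pi I) (prodAction I σ) where
  smooth := contMDiff_prodAction fun j => (h j).smooth
  map_lie x x' := by
    funext y
    rw [mlieBracket_prodAction fun j => (h j).smooth]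
    simp only [← (h _).map_lie]
    rfl

omit [∀ j, FiniteDimensional 𝕜 (E j)] [∀ j, IsManifold (I j) ∞ (Y j)] in
theorem actionTensor_prodAction_tensorTuple (r : ∀ j, 𝔤 j ⊗[𝕜] 𝔤 j) :
    actionTensor (ModelWithCorners.pi I) (prodAction I σ) (tensorTuple r) =
      prodTField I fun j => actionTensor (I j) (σ j) (r j) := by
  funext y
  simp only [actionTensor, prodTField, tensorTuple, map_sum, tensorMap_comp]
  refine Finset.sum_congr rfl fun j _ => ?_
  congr 2
  all_goals
    refine LinearMap.ext fun u => ?_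
    refine congrArg (tangentPi I y) (funext fun i => ?_)
    change σ i ((Pi.single j u : ∀ j, 𝔤 j) i) (y i) =
      (Pi.single j (σ j u (y j)) : ∀ j, TangentSpace (I j) (y j)) i
    by_cases hi : i = j
    · subst hi
      simp
    · simp [hi]

/-- Neither the product bivector field nor the product cobracket has cross terms, so both sides are
sums over the factors. -/
theorem isPoissonCompatible_prod (hπ : ∀ j, TField.IsSmooth (I j) (π j))
    (hσ : ∀ j x, ContMDiff (I j) (I j).tangent ∞
      (fun y => (⟨y, σ j x y⟩ : TangentBundle (I j) (Y j))))
    (h : ∀ j, IsPoissonCompatible (I j) (δ j) (π j) (σ j)) :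
    IsPoissonCompatible (ModelWithCorners.pi I) (prodCobracket δ) (prodTField I π)
      (prodAction I σ) := by
  intro x y α β
  have e : prodCobracket δ x = tensorTuple fun j => δ j (x j) := rfl
  rw [e, actionTensor_prodAction_tensorTuple, tensorEval_prodTField]
  simp only [← h _ _ _ _ _]
  unfold schoutenBracketVector
  rw [covector_prodAction, tensorEval_prodTField, tensorEval_prodTField,
    ← Finset.sum_sub_distrib, ← Finset.sum_sub_distrib]
  refine Finset.sum_congr rfl fun j _ => ?_
  rw [restrictCovector_differential_component hπ]
  have hv := fun γ => restrictCovector_differential_vectorComponent hσ x y γ j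
  unfold vectorComponent at hv
  rw [hv, hv]

theorem isLeftPoissonSpace_prod (h : ∀ j, IsLeftPoissonSpace (I j) (δ j) (π j) (σ j)) :
    IsLeftPoissonSpace (ModelWithCorners.pi I) (prodCobracket δ) (prodTField I π)
      (prodAction I σ) where
  bialgebra := isLieBialgebra_prodCobracket fun j => (h j).bialgebra
  poisson := isPoisson_prodTField fun j => (h j).poisson
  action := isLeftAction_prodAction fun j => (h j).action
  compatible := isPoissonCompatible_prod (fun j => (h j).poisson.smooth)
    (fun j => (h j).action.smooth) fun j => (h j).compatible

theorem isRightPoissonSpace_prod (h : ∀ j, IsRightPoissonSpace (I j) (δ j) (π j) (σ j)) :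
    IsRightPoissonSpace (ModelWithCorners.pi I) (prodCobracket δ) (prodTField I π)
      (prodAction I σ) where
  bialgebra := isLieBialgebra_prodCobracket fun j => (h j).bialgebra
  poisson := isPoisson_prodTField fun j => (h j).poisson
  action := isRightAction_prodAction fun j => (h j).action
  compatible := isPoissonCompatible_prod (fun j => (h j).poisson.smooth)
    (fun j => (h j).action.smooth) fun j => (h j).compatible

end ProductManifold

/-! ### Projection of Poisson structures along maps linear in charts. -/

section Descent

variable {𝕜 : Type*} [RCLike 𝕜] {E : Type*} [NormedAddCommGroup E] [NormedSpace 𝕜 E]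
  {H : Type*} [TopologicalSpace H] {I : ModelWithCorners 𝕜 E H}
  {M : Type*} [TopologicalSpace M] [ChartedSpace H M]
  {E' : Type*} [NormedAddCommGroup E'] [NormedSpace 𝕜 E']
  {H' : Type*} [TopologicalSpace H'] {I' : ModelWithCorners 𝕜 E' H'}
  {N : Type*} [TopologicalSpace N] [ChartedSpace H' N]
  {φ : M → N} {π : TField I M} {π' : TField I' N}

variable (I I') in
/-- The pullback of a covector by the differential of `φ`. -/
def pullbackCovector (φ : M → N) (y : M) (α : Module.Dual 𝕜 (TangentSpace I' (φ y))) :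
    Module.Dual 𝕜 (TangentSpace I y) :=
  α ∘ₗ (mfderiv I I' φ y).toLinearMap

variable (I I') in
/-- `φ` is linear in the preferred charts. -/
def IsChartLinear (φ : M → N) : Prop :=
  ∀ y z : M, extChartAt I' (φ y) (φ z) =
    (mfderiv I I' φ y : TangentSpace I y → TangentSpace I' (φ y)) (extChartAt I y z)

theorem ProjectsTo.tensorEval_pullbackCovector (h : ProjectsTo φ π π') (y : M)
    (α β : Module.Dual 𝕜 (TangentSpace I' (φ y))) :
    tensorEval (pullbackCovector I I' φ y α) (pullbackCovector I I' φ y β) (π y) =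
      tensorEval α β (π' (φ y)) := by
  rw [← h y, tensorEval_tensorMap]
  rfl

variable [FiniteDimensional 𝕜 E'] [IsManifold I' ∞ N]

/-- Chart linearity makes the pullback by `φ` of a coordinate function again a coordinate function,
so components upstairs on pulled-back covectors are pullbacks of components downstairs. -/
theorem IsChartLinear.coordForm_pullbackCovector (hl : IsChartLinear I I' φ)
    (hφ : ContMDiff I I' ∞ φ) {y z : M} (hz : φ z ∈ (chartAt H' (φ y)).source)
    (α : Module.Dual 𝕜 (TangentSpace I' (φ y))) :
    coordForm I y (pullbackCovector I I' φ y α) z =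
      pullbackCovector I I' φ z (coordForm I' (φ y) α (φ z)) := by
  have h : coordFun I y (pullbackCovector I I' φ y α) = fun z => coordFun I' (φ y) α (φ z) := by
    funext z
    exact (congrArg α (hl y z)).symm
  rw [coordForm, h]
  exact differential_comp ((contMDiffAt_coordFun hz α).mdifferentiableAt (by simp))
    (hφ.mdifferentiable (by simp) z).hasMFDerivAt

theorem IsChartLinear.component_eventuallyEq (hl : IsChartLinear I I' φ)
    (hφ : ContMDiff I I' ∞ φ) (h : ProjectsTo φ π π') (y : M)
    (α β : Module.Dual 𝕜 (TangentSpace I' (φ y))) :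
    TField.component I π y (pullbackCovector I I' φ y α) (pullbackCovector I I' φ y β) =ᶠ[nhds y]
      fun z => TField.component I' π' (φ y) α β (φ z) := by
  filter_upwards [hφ.continuous.continuousAt.preimage_mem_nhds
    ((chartAt H' (φ y)).open_source.mem_nhds (mem_chart_source H' (φ y)))] with z hz
  rw [TField.component, hl.coordForm_pullbackCovector hφ hz,
    hl.coordForm_pullbackCovector hφ hz, h.tensorEval_pullbackCovector]
  rfl

/-- Poisson structures descend along surjective maps with local sections. -/
theorem IsPoisson.of_projectsTo (hπ : IsPoisson I π) (h : ProjectsTo φ π π')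
    (hl : IsChartLinear I I' φ) (hφ : ContMDiff I I' ∞ φ) (hsurj : Function.Surjective φ)
    (hsec : ∀ y, ∃ s : N → M, ContMDiff I' I ∞ s ∧ s (φ y) = y ∧ ∀ q, φ (s q) = q) :
    IsPoisson I' π' := by
  -- Smoothness comes first: the chain rule in the Schouten step needs differentiable components of
  -- `π'`.
  have hsmooth : TField.IsSmooth I' π' := by
    intro q
    obtain ⟨y, rfl⟩ := hsurj q
    intro α β
    obtain ⟨s, hs, hsy, hφs⟩ := hsec y
    have h1 := hπ.smooth y (pullbackCovector I I' φ y α) (pullbackCovector I I' φ y β)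
    have h2 := hl.component_eventuallyEq hφ h y α β
    have hs' : Filter.Tendsto s (nhds (φ y)) (nhds y) := by
      have := (hs (φ y)).continuousAt.tendsto
      rwa [hsy] at this
    -- Composing a component of `π` with a section through `y` recovers the component of `π'`.
    refine (ContMDiffAt.comp_of_eq h1 (hs (φ y)) hsy).congr_of_eventuallyEq ?_
    filter_upwards [hs'.eventually h2] with q hq
    rw [Function.comp_apply, hq, hφs]
  refine ⟨hsmooth, fun q => ?_, fun q => ?_⟩
  · obtain ⟨y, rfl⟩ := hsurj q
    rw [← h y]
    exact (hπ.skew y).tensorMap _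
  · obtain ⟨y, rfl⟩ := hsurj q
    intro α β γ
    have hd : ∀ α β : Module.Dual 𝕜 (TangentSpace I' (φ y)),
        differential I (TField.component I π y (pullbackCovector I I' φ y α)
          (pullbackCovector I I' φ y β)) y =
        pullbackCovector I I' φ y
          (differential I' (TField.component I' π' (φ y) α β) (φ y)) := by
      intro α β
      rw [differential_congr (hl.component_eventuallyEq hφ h y α β)]
      exact differential_comp ((hsmooth (φ y) α β).mdifferentiableAt (by simp))
        (hφ.mdifferentiable (by simp) y).hasMFDerivAt
    have hs := hπ.schouten y (pullbackCovector I I' φ y α) (pullbackCovector I I' φ y β)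
      (pullbackCovector I I' φ y γ)
    unfold schoutenBracket at hs ⊢
    simpa only [hd, h.tensorEval_pullbackCovector] using hs

omit [FiniteDimensional 𝕜 E'] [IsManifold I' ∞ N] in
theorem isPoisson_zero : IsPoisson I' (0 : TField I' N) := by
  have h : ∀ (y : N) (α β : Module.Dual 𝕜 (TangentSpace I' y)),
      TField.component I' (0 : TField I' N) y α β = fun _ => 0 := by
    intro y α β
    funext z
    exact tensorEval_zero _ _
  refine ⟨fun y α β => ?_, fun y => ?_, fun y α β γ => ?_⟩
  · rw [h]
    exact contMDiffAt_const
  · simp [IsSkew]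
  · simp [schoutenBracket]

end Descent

/-! ### Projections to two factors and the mixed product property. -/

section Pairs

variable {𝕜 : Type*} [RCLike 𝕜] {n : ℕ} {E : Fin n → Type*} [∀ j, NormedAddCommGroup (E j)]
  [∀ j, NormedSpace 𝕜 (E j)] {H : Fin n → Type*} [∀ j, TopologicalSpace (H j)]
  {I : ∀ j, ModelWithCorners 𝕜 (E j) (H j)}
  {Y : Fin n → Type*} [∀ j, TopologicalSpace (Y j)] [∀ j, ChartedSpace (H j) (Y j)]
  {𝔤 : Fin n → Type*} [∀ j, LieRing (𝔤 j)] [∀ j, LieAlgebra 𝕜 (𝔤 j)]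
  {π : ∀ j, TField (I j) (Y j)} {σ : ∀ j, 𝔤 j →ₗ[𝕜] VField (I j) (Y j)}

/-- The projection of `Y₁ × ⋯ × Yₙ` to `Yᵢ × Yⱼ`. -/
def pairProj (Y : Fin n → Type*) (i j : Fin n) (y : ∀ j, Y j) : Y i × Y j := (y i, y j)

variable (I) in
/-- The identification `T_a Yᵢ ⊕ T_b Yⱼ = T_{(a, b)}(Yᵢ × Yⱼ)`. -/
def tangentPair (i j : Fin n) (q : Y i × Y j) :
    TangentSpace (I i) q.1 × TangentSpace (I j) q.2 →ₗ[𝕜]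
      TangentSpace ((I i).prod (I j)) q where
  toFun v := v
  map_add' _ _ := rfl
  map_smul' _ _ := rfl

variable (σ) in
/-- The action `(x₁, …, xₙ) ↦ (σᵢ(xᵢ), σⱼ(xⱼ))` on `Yᵢ × Yⱼ`. -/
def pairAction (i j : Fin n) : (∀ j, 𝔤 j) →ₗ[𝕜] VField ((I i).prod (I j)) (Y i × Y j) where
  toFun x q := tangentPair I i j q (σ i (x i) q.1, σ j (x j) q.2)
  map_add' x x' := by
    funext q
    simp only [Pi.add_apply, map_add]
    exact map_add (tangentPair I i j q) (_, _) (_, _)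
  map_smul' c x := by
    funext q
    simp only [Pi.smul_apply, map_smul, RingHom.id_apply]
    exact map_smul (tangentPair I i j q) c (_, _)

variable (π) in
/-- The tensor field `(πᵢ, πⱼ)` on `Yᵢ × Yⱼ`. -/
def pairTField (i j : Fin n) : TField ((I i).prod (I j)) (Y i × Y j) := fun q =>
  tensorMap (tangentPair I i j q ∘ₗ LinearMap.inl 𝕜 _ _) (π i q.1)
    + tensorMap (tangentPair I i j q ∘ₗ LinearMap.inr 𝕜 _ _) (π j q.2)

theorem contMDiff_pairProj (i j : Fin n) :
    ContMDiff (ModelWithCorners.pi I) ((I i).prod (I j)) ∞ (pairProj Y i j) :=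
  (contMDiff_pi_apply i).prodMk (contMDiff_pi_apply j)

theorem mfderiv_pairProj (i j : Fin n) (y : ∀ j, Y j) (v : ∀ j, TangentSpace (I j) (y j)) :
    mfderiv (ModelWithCorners.pi I) ((I i).prod (I j)) (pairProj Y i j) y (tangentPi I y v) =
      tangentPair I i j (pairProj Y i j y) (v i, v j) := by
  have h := ((hasMFDerivAt_pi_apply (I := I) y i).prodMk (hasMFDerivAt_pi_apply y j)).mfderiv
  exact DFunLike.congr_fun h (tangentPi I y v)

theorem isChartLinear_pairProj (i j : Fin n) :
    IsChartLinear (ModelWithCorners.pi I) ((I i).prod (I j)) (pairProj Y i j) := by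
  intro y z
  refine Eq.trans ?_ (mfderiv_pairProj i j y fun j => extChartAt (I j) (y j) (z j)).symm
  rw [extChartAt_prod]
  rfl

theorem projectsTo_pairTField {i j : Fin n} (hij : i ≠ j) :
    ProjectsTo (pairProj Y i j) (prodTField I π) (pairTField π i j) := by
  intro y
  have h : ∀ k (D : TangentSpace (I k) (y k) →ₗ[𝕜]
        TangentSpace ((I i).prod (I j)) (pairProj Y i j y)),
      (∀ v, D v = tangentPair I i j (pairProj Y i j y)
        ((Pi.single k v : ∀ j, TangentSpace (I j) (y j)) i,
          (Pi.single k v : ∀ j, TangentSpace (I j) (y j)) j)) →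
      tensorMap (mfderiv (ModelWithCorners.pi I) ((I i).prod (I j)) (pairProj Y i j) y).toLinearMap
        (tensorMap (tangentPi I y) (tensorMap (LinearMap.single 𝕜
          (fun j => TangentSpace (I j) (y j)) k) (π k (y k)))) = tensorMap D (π k (y k)) := by
    intro k D hD
    rw [tensorMap_comp, tensorMap_comp]
    congr 1
    congr 1
    all_goals exact LinearMap.ext fun v => (mfderiv_pairProj i j y _).trans (hD v).symm
  -- The differential of the projection kills every tangent summand except those of the factors `i`
  -- and `j`.
  rw [prodTField, tensorTuple, map_sum, map_sum, Finset.sum_eq_add i j hij]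
  · refine congrArg₂ (· + ·) (h i _ fun v => ?_) (h j _ fun v => ?_)
    · rw [Pi.single_eq_same, Pi.single_eq_of_ne hij.symm]
      rfl
    · rw [Pi.single_eq_same, Pi.single_eq_of_ne hij]
      rfl
  · rintro k - ⟨hki, hkj⟩
    refine (h k 0 fun v => ?_).trans (tensorMap_zero _)
    rw [Pi.single_eq_of_ne hki.symm, Pi.single_eq_of_ne hkj.symm]
    rfl
  · simp
  · simp

theorem projectsTo_actionTensor_pairAction (i j : Fin n)
    (t : (∀ j, 𝔤 j) ⊗[𝕜] (∀ j, 𝔤 j)) :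
    ProjectsTo (pairProj Y i j) (actionTensor (ModelWithCorners.pi I) (prodAction I σ) t)
      (actionTensor ((I i).prod (I j)) (pairAction σ i j) t) := by
  intro y
  rw [actionTensor, tensorMap_comp, actionTensor]
  congr 1
  congr 1
  all_goals exact LinearMap.ext fun x => mfderiv_pairProj i j y fun j => σ j (x j) (y j)

theorem ProjectsTo.add_smul {E : Type*} [NormedAddCommGroup E] [NormedSpace 𝕜 E]
    {H : Type*} [TopologicalSpace H] {I : ModelWithCorners 𝕜 E H}
    {M : Type*} [TopologicalSpace M] [ChartedSpace H M]
    {E' : Type*} [NormedAddCommGroup E'] [NormedSpace 𝕜 E']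
    {H' : Type*} [TopologicalSpace H'] {I' : ModelWithCorners 𝕜 E' H'}
    {N : Type*} [TopologicalSpace N] [ChartedSpace H' N]
    {φ : M → N} {A B : TField I M} {A' B' : TField I' N} (hA : ProjectsTo φ A A')
    (hB : ProjectsTo φ B B') (c : 𝕜) : ProjectsTo φ (A + c • B) (A' + c • B') := by
  intro y
  rw [Pi.add_apply, Pi.smul_apply, map_add, map_smul, hA y, hB y]
  rfl

theorem projectsTo_fst_pairTField (i j : Fin n) :
    ProjectsTo Prod.fst (pairTField π i j) (π i) := by
  intro q
  rw [pairTField, map_add, tensorMap_comp, tensorMap_comp, mfderiv_fst]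
  have h1 : tensorMap LinearMap.id (π i q.1) = π i q.1 := by simp [tensorMap]
  have h2 : tensorMap (0 : TangentSpace (I j) q.2 →ₗ[𝕜] TangentSpace (I i) q.1) (π j q.2) = 0 :=
    tensorMap_zero _
  exact (congrArg₂ (· + ·) h1 h2).trans (add_zero _)

theorem projectsTo_snd_pairTField (i j : Fin n) :
    ProjectsTo Prod.snd (pairTField π i j) (π j) := by
  intro q
  rw [pairTField, map_add, tensorMap_comp, tensorMap_comp, mfderiv_snd]
  have h1 : tensorMap LinearMap.id (π j q.2) = π j q.2 := by simp [tensorMap]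
  have h2 : tensorMap (0 : TangentSpace (I i) q.1 →ₗ[𝕜] TangentSpace (I j) q.2) (π i q.1) = 0 :=
    tensorMap_zero _
  exact (congrArg₂ (· + ·) h2 h1).trans (zero_add _)

/-- After projection to the factor `i`, the pair action factors through `𝔤 → 𝔤ᵢ`, under which `t`
has image zero. This is where mixedness of the twisting element enters. -/
theorem projectsTo_fst_pairAction (i j : Fin n) {t : (∀ j, 𝔤 j) ⊗[𝕜] (∀ j, 𝔤 j)}
    (ht : tensorMap (LinearMap.proj (R := 𝕜) (φ := 𝔤) i) t = 0) :
    ProjectsTo Prod.fst (actionTensor ((I i).prod (I j)) (pairAction σ i j) t)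
      (0 : TField (I i) (Y i)) := by
  intro q
  rw [actionTensor, tensorMap_comp, mfderiv_fst]
  have h := congrArg (tensorMap (LinearMap.proj q.1 ∘ₗ σ i)) ht
  rw [tensorMap_comp, map_zero] at h
  exact h

theorem projectsTo_snd_pairAction (i j : Fin n) {t : (∀ j, 𝔤 j) ⊗[𝕜] (∀ j, 𝔤 j)}
    (ht : tensorMap (LinearMap.proj (R := 𝕜) (φ := 𝔤) j) t = 0) :
    ProjectsTo Prod.snd (actionTensor ((I i).prod (I j)) (pairAction σ i j) t)
      (0 : TField (I j) (Y j)) := by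
  intro q
  rw [actionTensor, tensorMap_comp, mfderiv_snd]
  have h := congrArg (tensorMap (LinearMap.proj q.2 ∘ₗ σ j)) ht
  rw [tensorMap_comp, map_zero] at h
  exact h

theorem exists_section_pairProj {i j : Fin n} (hij : i ≠ j) (y : ∀ j, Y j) :
    ∃ s : Y i × Y j → ∀ j, Y j, ContMDiff ((I i).prod (I j)) (ModelWithCorners.pi I) ∞ s ∧
      s (pairProj Y i j y) = y ∧ ∀ q, pairProj Y i j (s q) = q := by
  -- The section freezes all coordinates of `y` other than `i` and `j`.
  refine ⟨fun q => Function.update (Function.update y i q.1) j q.2, ?_, ?_, ?_⟩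
  · refine contMDiff_pi_iff.2 fun k => ?_
    by_cases hj : k = j
    · subst hj
      simpa using contMDiff_snd
    · simp only [Function.update_of_ne hj]
      by_cases hi : k = i
      · subst hi
        simpa using contMDiff_fst
      · simp only [Function.update_of_ne hi]
        exact contMDiff_const
  · simp [pairProj]
  · intro q
    simp [pairProj, hij]

theorem isMixedProductTwo_zero (i j : Fin n) :
    IsMixedProductTwo (I i) (I j) (0 : TField ((I i).prod (I j)) (Y i × Y j)) :=
  ⟨isPoisson_zero, ⟨0, isPoisson_zero, fun _ => map_zero _⟩,
    ⟨0, isPoisson_zero, fun _ => map_zero _⟩⟩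

/-- A Poisson structure `(π₁, …, πₙ) + c σ(t)` on `Y₁ × ⋯ × Yₙ` is a mixed product if the diagonal
components of `t` vanish. -/
theorem isMixedProduct_prodTField_add_smul [∀ j, FiniteDimensional 𝕜 (E j)]
    [∀ j, IsManifold (I j) ∞ (Y j)] {t : (∀ j, 𝔤 j) ⊗[𝕜] (∀ j, 𝔤 j)}
    (ht : ∀ j, tensorMap (LinearMap.proj (R := 𝕜) (φ := 𝔤) j) t = 0)
    (hπ : ∀ j, IsPoisson (I j) (π j)) (c : 𝕜)
    (h : IsPoisson (ModelWithCorners.pi I)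
      (prodTField I π + c • actionTensor (ModelWithCorners.pi I) (prodAction I σ) t)) :
    IsMixedProduct I
      (prodTField I π + c • actionTensor (ModelWithCorners.pi I) (prodAction I σ) t) := by
  refine ⟨h, fun i j hij => ?_⟩
  -- If some other factor is empty, `Yᵢ × Yⱼ` may still be nonempty and the projection not
  -- surjective. Being projectable is then vacuous, and the zero structure serves.
  rcases isEmpty_or_nonempty (∀ j, Y j) with hY | ⟨⟨y⟩⟩
  · exact ⟨0, isMixedProductTwo_zero i j, fun y => hY.elim y⟩
  have hp := (projectsTo_pairTField (π := π) hij.ne).add_smul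
    (projectsTo_actionTensor_pairAction (σ := σ) i j t) c
  have hsurj : Function.Surjective (pairProj Y i j) := fun q => by
    obtain ⟨s, -, -, hs⟩ := exists_section_pairProj (I := I) hij.ne y
    exact ⟨s q, hs q⟩
  refine ⟨pairTField π i j + c • actionTensor ((I i).prod (I j)) (pairAction σ i j) t,
    ⟨h.of_projectsTo hp (isChartLinear_pairProj i j) (contMDiff_pairProj i j) hsurj
      (exists_section_pairProj hij.ne), ⟨π i, hπ i, ?_⟩, ⟨π j, hπ j, ?_⟩⟩, hp⟩
  · simpa using (projectsTo_fst_pairTField (π := π) i j).add_smul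
      (projectsTo_fst_pairAction (σ := σ) i j (ht i)) c
  · simpa using (projectsTo_snd_pairTField (π := π) i j).add_smul
      (projectsTo_snd_pairAction (σ := σ) i j (ht j)) c

end Pairs

end

/-! ### The proposition. -/

theorem mainTheorem5 {𝕜 : Type*} [RCLike 𝕜] {n : ℕ} (hn : 2 ≤ n)
    -- the Lie bialgebras and the mixed twisting element
    {𝔤 : Fin n → Type*} [∀ j, LieRing (𝔤 j)] [∀ j, LieAlgebra 𝕜 (𝔤 j)]
    [∀ j, FiniteDimensional 𝕜 (𝔤 j)]
    (δ : ∀ j, 𝔤 j →ₗ[𝕜] 𝔤 j ⊗[𝕜] 𝔤 j) (hδ : ∀ j, IsLieBialgebra (δ j))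
    (t : (∀ j, 𝔤 j) ⊗[𝕜] (∀ j, 𝔤 j)) (ht : IsMixedTwistingElement δ t)
    -- the manifolds
    {E : Fin n → Type*} [∀ j, NormedAddCommGroup (E j)] [∀ j, NormedSpace 𝕜 (E j)]
    [∀ j, FiniteDimensional 𝕜 (E j)]
    {Y : Fin n → Type*} [∀ j, TopologicalSpace (Y j)] [∀ j, ChartedSpace (E j) (Y j)]
    [∀ j, IsManifold 𝓘(𝕜, E j) ∞ (Y j)]
    -- the bi-vector fields and the actions
    (π : ∀ j, TField 𝓘(𝕜, E j) (Y j)) (σ : ∀ j, 𝔤 j →ₗ[𝕜] VField 𝓘(𝕜, E j) (Y j)) :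
    -- left Poisson spaces
    ((∀ j, IsLeftPoissonSpace 𝓘(𝕜, E j) (δ j) (π j) (σ j)) →
      let J := ModelWithCorners.pi fun j => 𝓘(𝕜, E j)
      let act : (∀ j, 𝔤 j) →ₗ[𝕜] VField J (∀ j, Y j) := prodAction (fun j => 𝓘(𝕜, E j)) σ
      let piY : TField J (∀ j, Y j) :=
        prodTField (fun j => 𝓘(𝕜, E j)) π + actionTensor J act t
      IsMixedProduct (fun j => 𝓘(𝕜, E j)) piY ∧
      IsLeftPoissonSpace J (twistedCobracket (prodCobracket δ) t) piY act ∧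
      ∀ r : ∀ j, 𝔤 j ⊗[𝕜] 𝔤 j, (∀ j, IsQuasitriangularStructure (δ j) (r j)) →
        (∀ j, π j = -actionTensor 𝓘(𝕜, E j) (σ j) (r j)) →
        piY = -actionTensor J act (tensorTuple r - t)) ∧
    -- right Poisson spaces
    ((∀ j, IsRightPoissonSpace 𝓘(𝕜, E j) (δ j) (π j) (σ j)) →
      let J := ModelWithCorners.pi fun j => 𝓘(𝕜, E j)
      let act : (∀ j, 𝔤 j) →ₗ[𝕜] VField J (∀ j, Y j) := prodAction (fun j => 𝓘(𝕜, E j)) σ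
      let piY : TField J (∀ j, Y j) :=
        prodTField (fun j => 𝓘(𝕜, E j)) π - actionTensor J act t
      IsMixedProduct (fun j => 𝓘(𝕜, E j)) piY ∧
      IsRightPoissonSpace J (twistedCobracket (prodCobracket δ) t) piY act ∧
      ∀ r : ∀ j, 𝔤 j ⊗[𝕜] 𝔤 j, (∀ j, IsQuasitriangularStructure (δ j) (r j)) →
        (∀ j, π j = actionTensor 𝓘(𝕜, E j) (σ j) (r j)) →
        piY = actionTensor J act (tensorTuple r - t)) := by
  constructor
  · intro h J act piY
    have hP : IsLeftPoissonSpace J (twistedCobracket (prodCobracket δ) t) piY act :=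
      (isLeftPoissonSpace_prod h).twist ht.twisting
    have e : piY = prodTField (fun j => 𝓘(𝕜, E j)) π + (1 : 𝕜) • actionTensor J act t := by
      rw [one_smul]
    refine ⟨?_, hP, fun r _ hπr => ?_⟩
    · rw [e]
      exact isMixedProduct_prodTField_add_smul ht.mixed (fun j => (h j).poisson) 1
        (e ▸ hP.poisson)
    -- The product action carries `(r₁, …, rₙ)` to the tuple of the `σⱼ(rⱼ)`; the twist term then
    -- joins by linearity in the tensor.
    · have hr : prodTField (fun j => 𝓘(𝕜, E j)) π = -actionTensor J act (tensorTuple r) := by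
        rw [actionTensor_prodAction_tensorTuple, funext hπr]
        funext y
        simp [prodTField, tensorTuple]
      funext y
      simp [piY, hr, actionTensor, neg_add_eq_sub]
  · intro h J act piY
    have hP : IsRightPoissonSpace J (twistedCobracket (prodCobracket δ) t) piY act :=
      (isRightPoissonSpace_prod h).twist ht.twisting
    have e : piY = prodTField (fun j => 𝓘(𝕜, E j)) π + (-1 : 𝕜) • actionTensor J act t := by
      rw [neg_one_smul, ← sub_eq_add_neg]
    refine ⟨?_, hP, fun r _ hπr => ?_⟩
    · rw [e]
      exact isMixedProduct_prodTField_add_smul ht.mixed (fun j => (h j).poisson) (-1)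
        (e ▸ hP.poisson)
    · have hr : prodTField (fun j => 𝓘(𝕜, E j)) π = actionTensor J act (tensorTuple r) := by
        rw [actionTensor_prodAction_tensorTuple, funext hπr]
      funext y
      simp [piY, hr, actionTensor]
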